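/- Let $n\ge 1$, $0<s<1$, let $\Omega\subset\mathbb{R}^n$ be a domain (nonempty, open, connected), let $\vec b\in C^1(\Omega;\mathbb{R}^n)$ and $c\in L^\infty(\Omega)$ with $\|\vec b\|_{C^1(\Omega)}+\|c\|_{L^\infty(\Omega)}<\infty$. Let $$\mathcal{L}_{2s}=\Big\{u:\mathbb{R}^n\to\mathbb{R}\ \text{measurable}\ :\ \int_{\mathbb{R}^n}\frac{|u(y)|}{1+|y|^{n+2s}}\,dy<\infty\Big\},$$ and for $\varphi\in C_0^\infty(\mathbb{R}^n)$ let $$(-\Delta)^s\varphi(x)=C_{n,s}\,\mathrm{P.V.}\!\int_{\mathbb{R}^n}\frac{\varphi(x)-\varphi(y)}{|x-y|^{n+2s}}\,dy,\qquad C_{n,s}=\frac{4^s\,s\,\Gamma(\frac n2+s)}{\pi^{n/2}\,\Gamma(1-s)}.$$ For $u\in\mathcal{L}_{2s}$ and $f\in L^1_{\rm loc}(\Omega)$, we say that $(-\Delta)^su+\vec b\cdot\nabla u+cu\le f$ in $\mathcal{D}'(\Omega)$ if $$\int_{\mathbb{R}^n}u\,(-\Delta)^s\varphi\,dx-\int_\Omega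 u\,\mathrm{div}(\varphi\,\vec b)\,dx+\int_\Omega c\,u\,\varphi\,dx\le\int_\Omega f\varphi\,dx\qquad\text{for all }0\le\varphi\in C_0^\infty(\Omega).$$ Assume that $u,v\in\mathcal{L}_{2s}$ and $f,g\in L^1_{\rm loc}(\Omega)$ satisfy $$(-\Delta)^su+\vec b\cdot\nabla u+cu\le f\quad\text{and}\quad(-\Delta)^sv+\vec b\cdot\nabla v+cv\le g\qquad\text{in }\mathcal{D}'(\Omega).$$ Then $w=\max\{u,v\}$ belongs to $\mathcal{L}_{2s}$, the function $f\chi_{\{u>v\}}+g\chi_{\{u<v\}}+\max\{f,g\}\chi_{\{u=v\}}$ belongs to $L^1_{\rm loc}(\Omega)$, and $$(-\Delta)^sw+\vec b\cdot\nabla w+cw\le f\chi_{\{u>v\}}+g\chi_{\{u<v\}}+\max\{f,g\}\chi_{\{u=v\}}\qquad\text{in }\mathcal{D}'(\Omega).$$ -/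

import Mathlib

open MeasureTheory Filter Topology TopologicalSpace Set
open scoped Distributions ENNReal

noncomputable section

namespace FracMax

/-- The Euclidean space `ℝⁿ`. -/
abbrev Rn (n : ℕ) : Type := EuclideanSpace ℝ (Fin n)

/-- The normalizing constant
`C_{n,s} = 4^s s Γ(n/2 + s) / (π^{n/2} Γ(1 - s)) = 4^s Γ(n/2 + s) / (π^{n/2} |Γ(-s)|)`
of the fractional Laplacian. -/
def fracConst (n : ℕ) (s : ℝ) : ℝ :=
  (4 : ℝ) ^ s * s * Real.Gamma ((n : ℝ) / 2 + s) /
    (Real.pi ^ ((n : ℝ) / 2) * Real.Gamma (1 - s))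

/-- The truncated singular integral over `{y : |x - y| > ε}`. -/
def fracTrunc {n : ℕ} (s : ℝ) (φ : Rn n → ℝ) (x : Rn n) (ε : ℝ) : ℝ :=
  ∫ y in {y : Rn n | ε < ‖x - y‖}, (φ x - φ y) / ‖x - y‖ ^ ((n : ℝ) + 2 * s)

/-- The pointwise fractional Laplacian
`(-Δ)^s φ(x) = C_{n,s} P.V. ∫ (φ(x) - φ(y)) / |x - y|^{n+2s} dy`; it is only applied to
test functions, for which the limit defining the principal value exists. -/
def fracLaplacian {n : ℕ} (s : ℝ) (φ : Rn n → ℝ) (x : Rn n) : ℝ :=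
  fracConst n s * limUnder (𝓝[>] (0 : ℝ)) (fracTrunc s φ x)

/-- The class `𝓛_α` of (almost everywhere strongly measurable) functions `u : ℝⁿ → ℝ` with
`∫ |u(y)| / (1 + |y|^{n+α}) dy < ∞`. -/
def MemL {n : ℕ} (α : ℝ) (u : Rn n → ℝ) : Prop :=
  Integrable (fun y => u y / (1 + ‖y‖ ^ ((n : ℝ) + α))) volume

/-- The divergence `∑ i, ∂ᵢ Fᵢ` of a vector field. -/
def divergence {n : ℕ} (F : Rn n → Rn n) (x : Rn n) : ℝ :=
  ∑ i, fderiv ℝ F x (EuclideanSpace.single i 1) i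

/-- `‖b‖_{C¹(Ω)} < ∞`: `b` is continuously differentiable on the open set `Ω`, and `b` and its
derivative are bounded there. -/
def BoundedC1On {n : ℕ} (b : Rn n → Rn n) (Ω : Opens (Rn n)) : Prop :=
  ContDiffOn ℝ 1 b (Ω : Set (Rn n)) ∧
    ∃ M : ℝ, ∀ x ∈ Ω, ‖b x‖ ≤ M ∧ ‖fderiv ℝ b x‖ ≤ M

/-- The distribution `(-Δ)^s u` on `Ω`, evaluated at a test function:
`⟨(-Δ)^s u, φ⟩ = ∫_{ℝⁿ} u (-Δ)^s φ`. -/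
def fracLaplacianDistr {n : ℕ} {Ω : Opens (Rn n)} (s : ℝ) (u : Rn n → ℝ) (φ : 𝓓(Ω, ℝ)) : ℝ :=
  ∫ x, u x * fracLaplacian s φ x

/-- The distribution `b · ∇u` on `Ω`, evaluated at a test function:
`⟨b · ∇u, φ⟩ = - ∫_Ω u div(φ b)`. -/
def driftDistr {n : ℕ} {Ω : Opens (Rn n)} (b : Rn n → Rn n) (u : Rn n → ℝ) (φ : 𝓓(Ω, ℝ)) : ℝ :=
  - ∫ x in (Ω : Set (Rn n)), u x * divergence (fun y => φ y • b y) x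

/-- The distribution on `Ω` given by a locally integrable function, evaluated at a test function. -/
def funDistr {n : ℕ} {Ω : Opens (Rn n)} (f : Rn n → ℝ) (φ : 𝓓(Ω, ℝ)) : ℝ :=
  ∫ x in (Ω : Set (Rn n)), f x * φ x

/-- `(-Δ)^s u + b · ∇u + c u ≤ f` in `𝓓'(Ω)`: the inequality holds when tested against every
nonnegative test function. -/
def IsSubsolution {n : ℕ} (Ω : Opens (Rn n)) (s : ℝ) (b : Rn n → Rn n) (c : Rn n → ℝ)
    (u f : Rn n → ℝ) : Prop :=
  ∀ φ : 𝓓(Ω, ℝ), (∀ x, 0 ≤ φ x) →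
    fracLaplacianDistr s u φ + driftDistr b u φ + funDistr (fun x => c x * u x) φ ≤ funDistr f φ

/-- The function `f χ_{u>v} + g χ_{u<v} + max{f,g} χ_{u=v}`. -/
def maxRhs {n : ℕ} (u v f g : Rn n → ℝ) (x : Rn n) : ℝ :=
  {y | v y < u y}.indicator f x + {y | u y < v y}.indicator g x +
    {y | u y = v y}.indicator (fun y => max (f y) (g y)) x

end FracMax

end

open MeasureTheory Filter Topology TopologicalSpace Set
open scoped Distributions ENNReal

noncomputable section

namespace FracMax

/-! Mollify: put `U = ρ * u`, `V = ρ * v`, `W = max U V`, with `ρ` an even mollifier at scale `ε`.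
Split a test function `φ ≥ 0` as `q₁ + q₂`, where `q₁` is `φ` cut off to `{U > V}` and `q₂` is `φ`
cut off to `{U ≤ V}`. The `qᵢ` are discontinuous, but `ρ * q₁` and `ρ * q₂` are admissible: smooth,
nonnegative and, for small `ε`, supported in `Ω`. Test the inequality for `u` with the first and
that for `v` with the second, add, and compare term by term with `W` tested against `φ`.

Nonlocal term. Truncated at `η`, the singular integral is `κ - k *` with an even integrable kernel
`k ≥ 0`. It is symmetric and commutes with mollification, so it can be moved from `ρ * q₁` onto `U`.
Where `U > V` one has `W = U`, while `k * W ≥ k * U`, so `(κ - k *) W ≤ (κ - k *) U` there, and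
likewise for `V` on the complement. Letting `η → 0` gives `integral_max_mul_fracLaplacian_le`.

Drift term. Mollification does not commute with `B · ∇`, but the commutator is bounded by the mean
oscillation of `u` at scale `ε` (`abs_integral_driftKernel_add_le`, an estimate of DiPerna–Lions
type), which tends to zero in the weighted space by continuity of translations. What remains is `q₁
B · ∇U + q₂ B · ∇V`, which is `φ B · ∇W` and integrates by parts (`integral_max_mul_divergence_ge`).

Source term. The zero-order term is absorbed into the sources `F = f - c u`, `G = g - c v`. Along a
sequence of scales with `U → u` and `V → v` almost everywhere, the cut-offs stabilise where `u ≠ v`.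
Where `u = v` nothing is known about them, and `max F G` is the bound that always holds
(`limit_source_le`). There `max F G = max f g - c u`, which is the source claimed in the statement.
-/

variable {n : ℕ}

/-! ### The weight and the truncated kernel -/

/-- The weight `1 / (1 + |x|^p)`. -/
def wt (p : ℝ) (x : Rn n) : ℝ := (1 + ‖x‖ ^ p)⁻¹

/-- The kernel `|x|^{-p}` truncated to `{|x| > η}`. -/
def kern (p η : ℝ) (x : Rn n) : ℝ := {x : Rn n | η < ‖x‖}.indicator (fun x => (‖x‖ ^ p)⁻¹) x

/-- The convolution `∫ u(y) k(x - y) dy`. -/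
def cv (k u : Rn n → ℝ) (x : Rn n) : ℝ := ∫ y, u y * k (x - y)

theorem wt_pos (p : ℝ) (x : Rn n) : 0 < wt p x := by
  unfold wt; positivity

theorem wt_le_one (p : ℝ) (x : Rn n) : wt p x ≤ 1 :=
  inv_le_one_of_one_le₀ (by have := Real.rpow_nonneg (norm_nonneg x) p; linarith)

theorem continuous_wt {p : ℝ} (hp : 0 ≤ p) : Continuous (wt p : Rn n → ℝ) := by
  unfold wt
  refine Continuous.inv₀ (continuous_const.add (continuous_norm.rpow_const fun _ => Or.inr hp)) ?_
  intro x
  have := Real.rpow_nonneg (norm_nonneg x) p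
  positivity

/-- From `‖x‖ ≤ (1 + R) max(‖x - h‖, 1)`, raised to the power `p`. Bounded translations therefore
preserve the weighted space, which is used for mollification, for kernels acting on compactly
supported functions and for continuity of translations. -/
theorem wt_sub_le {p R : ℝ} (hp : 0 ≤ p) (hR : 0 ≤ R) {x h : Rn n} (hh : ‖h‖ ≤ R) :
    wt p (x - h) ≤ (1 + (1 + R) ^ p) * wt p x := by
  have hx : ‖x‖ ≤ (1 + R) * max ‖x - h‖ 1 := by
    have h1 : ‖x‖ ≤ ‖x - h‖ + ‖h‖ := by simpa using norm_add_le (x - h) h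
    have h2 := le_max_left ‖x - h‖ 1
    have h3 := le_max_right ‖x - h‖ 1
    nlinarith
  have hxp : ‖x‖ ^ p ≤ (1 + R) ^ p * (‖x - h‖ ^ p + 1) := by
    refine (Real.rpow_le_rpow (norm_nonneg _) hx hp).trans ?_
    rw [Real.mul_rpow (by positivity) (by positivity)]
    gcongr
    rcases max_choice ‖x - h‖ 1 with e | e <;> rw [e]
    · linarith
    · rw [Real.one_rpow]
      linarith [Real.rpow_nonneg (norm_nonneg (x - h)) p]
  have ha := Real.rpow_nonneg (norm_nonneg (x - h)) p
  have hb := Real.rpow_nonneg (norm_nonneg x) p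
  have hc : 0 ≤ (1 + R) ^ p := by positivity
  unfold wt
  rw [← div_eq_mul_inv, inv_le_comm₀ (by positivity) (by positivity), inv_div,
    div_le_iff₀ (by positivity)]
  nlinarith

theorem wt_neg (p : ℝ) (x : Rn n) : wt p (-x) = wt p x := by simp [wt]

theorem wt_sub_le' {p R : ℝ} (hp : 0 ≤ p) (hR : 0 ≤ R) {x y : Rn n} (hx : ‖x‖ ≤ R) :
    wt p (x - y) ≤ (1 + (1 + R) ^ p) * wt p y := by
  rw [← wt_neg, neg_sub]
  exact wt_sub_le hp hR hx

theorem integrable_wt {p : ℝ} (hp : (n : ℝ) < p) : Integrable (wt p : Rn n → ℝ) := by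
  have hp0 : 0 ≤ p := (Nat.cast_nonneg n).trans hp.le
  have h := integrable_one_add_norm (E := Rn n) (μ := volume) (r := p) (by simpa using hp)
  refine (h.const_mul (2 ^ p)).mono' (continuous_wt hp0).aestronglyMeasurable
    (Eventually.of_forall fun x => ?_)
  rw [Real.norm_of_nonneg (wt_pos p x).le, Real.rpow_neg (by positivity), wt, ← div_eq_mul_inv,
    inv_le_comm₀ (by positivity) (by positivity), inv_div, div_le_iff₀ (by positivity)]
  have hx := norm_nonneg x
  have : (1 + ‖x‖) ^ p ≤ (2 * max 1 ‖x‖) ^ p :=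
    Real.rpow_le_rpow (by positivity)
      (by linarith [le_max_left 1 ‖x‖, le_max_right 1 ‖x‖]) hp0
  rw [Real.mul_rpow (by positivity) (by positivity)] at this
  refine this.trans ?_
  rw [mul_comm]
  gcongr
  rcases max_choice 1 ‖x‖ with e | e <;> rw [e]
  · rw [Real.one_rpow]; linarith [Real.rpow_nonneg hx p]
  · linarith

theorem kern_nonneg (p η : ℝ) (x : Rn n) : 0 ≤ kern p η x :=
  indicator_nonneg (fun x _ => by positivity) x

theorem kern_neg (p η : ℝ) (x : Rn n) : kern p η (-x) = kern p η x := by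
  simp [kern, indicator]

theorem measurable_kern (p η : ℝ) : Measurable (kern p η : Rn n → ℝ) := by
  unfold kern
  exact ((measurable_norm.pow_const p).inv).indicator (measurableSet_lt measurable_const measurable_norm)

/-- Truncation removes the singularity, and what is left decays like the weight. The constant blows
up as `η → 0`, which is harmless: it only justifies Fubini at a fixed `η`. -/
theorem kern_le {p η : ℝ} (hp : 0 ≤ p) (hη : 0 < η) (x : Rn n) :
    kern p η x ≤ (1 + (η ^ p)⁻¹) * wt p x := by
  unfold kern
  by_cases hx : η < ‖x‖
  · rw [indicator_of_mem (by exact hx)]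
    have hx0 : 0 < ‖x‖ := hη.trans hx
    have h1 : (‖x‖ ^ p)⁻¹ ≤ (η ^ p)⁻¹ := by gcongr
    have h2 : 0 < ‖x‖ ^ p := by positivity
    rw [wt, ← div_eq_mul_inv, le_div_iff₀ (by positivity), mul_add, mul_one,
      inv_mul_cancel₀ h2.ne']
    linarith
  · rw [indicator_of_notMem (by exact hx)]
    have := wt_pos p x
    positivity

theorem integrable_kern {p η : ℝ} (hp : (n : ℝ) < p) (hη : 0 < η) :
    Integrable (kern p η : Rn n → ℝ) := by
  refine ((integrable_wt hp).const_mul (1 + (η ^ p)⁻¹)).mono'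
    (measurable_kern p η).aestronglyMeasurable (Eventually.of_forall fun x => ?_)
  rw [Real.norm_of_nonneg (kern_nonneg p η x)]
  exact kern_le ((Nat.cast_nonneg n).trans hp.le) hη x

theorem memL_iff {s : ℝ} {u : Rn n → ℝ} :
    MemL (2 * s) u ↔ Integrable (fun x => u x * wt ((n : ℝ) + 2 * s) x) := by
  simp only [MemL, wt, div_eq_mul_inv]

/-! ### The truncated operator and the principal value -/

theorem fracTrunc_eq_integral (s : ℝ) (φ : Rn n → ℝ) (x : Rn n) (η : ℝ) :
    fracTrunc s φ x η = ∫ y, (φ x - φ y) * kern ((n : ℝ) + 2 * s) η (x - y) := by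
  unfold fracTrunc
  rw [← integral_indicator]
  · congr 1
    ext y
    by_cases h : η < ‖x - y‖
    · rw [indicator_of_mem (by exact h), kern, indicator_of_mem (by exact h), div_eq_mul_inv]
    · rw [indicator_of_notMem (by exact h), kern, indicator_of_notMem (by exact h), mul_zero]
  · exact measurableSet_lt measurable_const (by fun_prop)

theorem integrable_mul_kern_sub {p η : ℝ} (hp : (n : ℝ) < p) (hη : 0 < η) {u : Rn n → ℝ}
    (hum : Measurable u) (hu : Integrable (fun x => u x * wt p x)) (x : Rn n) :
    Integrable (fun y => u y * kern p η (x - y)) := by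
  have hp0 : 0 ≤ p := (Nat.cast_nonneg n).trans hp.le
  refine (hu.norm.const_mul ((1 + (η ^ p)⁻¹) * (1 + (1 + ‖x‖) ^ p))).mono'
    (hum.mul ((measurable_kern p η).comp (by fun_prop))).aestronglyMeasurable
    (Eventually.of_forall fun y => ?_)
  have h1 : kern p η (x - y) ≤ (1 + (η ^ p)⁻¹) * ((1 + (1 + ‖x‖) ^ p) * wt p y) :=
    (kern_le hp0 hη _).trans (by gcongr; exact wt_sub_le' hp0 (norm_nonneg _) le_rfl)
  rw [norm_mul, norm_mul, Real.norm_of_nonneg (kern_nonneg _ _ _),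
    Real.norm_of_nonneg (wt_pos _ _).le]
  calc _ ≤ ‖u y‖ * ((1 + (η ^ p)⁻¹) * ((1 + (1 + ‖x‖) ^ p) * wt p y)) := by gcongr
    _ = _ := by ring

theorem memL_of_integrable {p : ℝ} (hp : 0 ≤ p) {u : Rn n → ℝ} (hu : Integrable u) :
    Integrable (fun x => u x * wt p x) :=
  hu.mul_bdd (c := 1) (continuous_wt hp).aestronglyMeasurable
    (Eventually.of_forall fun x => by
      rw [Real.norm_of_nonneg (wt_pos _ _).le]; exact wt_le_one p x)

/-- For `η > 0` the kernel is integrable, so the two parts of the difference may be integrated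
separately. The form "constant minus convolution with a nonnegative kernel" is the source of the
maximum principle below. -/
theorem fracTrunc_eq_sub {s η : ℝ} (hs : 0 < s) (hη : 0 < η) {φ : Rn n → ℝ} (hφm : Measurable φ)
    (hφ : Integrable φ) (x : Rn n) :
    fracTrunc s φ x η = (∫ y : Rn n, kern ((n : ℝ) + 2 * s) η y) * φ x -
      cv (kern ((n : ℝ) + 2 * s) η) φ x := by
  have hp : (n : ℝ) < (n : ℝ) + 2 * s := by linarith
  have hp0 : (0 : ℝ) ≤ (n : ℝ) + 2 * s := by positivity
  rw [fracTrunc_eq_integral]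
  simp_rw [sub_mul]
  rw [integral_sub, integral_const_mul, integral_sub_left_eq_self, mul_comm]
  · rfl
  · exact ((integrable_kern hp hη).comp_sub_left x).const_mul _
  · exact integrable_mul_kern_sub hp hη hφm (memL_of_integrable hp0 hφ) x

theorem locallyIntegrable_of_memL {p : ℝ} (hp : 0 ≤ p) {u : Rn n → ℝ}
    (hu : Integrable (fun x => u x * wt p x)) : LocallyIntegrable u := by
  rw [locallyIntegrable_iff]
  intro K hK
  have h1 : ContinuousOn (fun x : Rn n => (wt p x)⁻¹) K :=
    ((continuous_wt hp).inv₀ fun x => (wt_pos p x).ne').continuousOn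
  refine (hu.integrableOn.mul_continuousOn h1 hK).congr_fun (fun x _ => ?_) hK.measurableSet
  exact mul_inv_cancel_right₀ (wt_pos p x).ne' _

/-- In polar coordinates the integrand is `r^(1 - 2s)` near zero, integrable since `s < 1`, and
`r^(-1 - 2s)` at infinity, integrable since `s > 0`. -/
theorem integrable_min_sq_mul_rpow_neg (hn : 1 ≤ n) {s : ℝ} (hs0 : 0 < s) (hs1 : s < 1) :
    Integrable (fun h : Rn n => min (‖h‖ ^ 2) 1 * (‖h‖ ^ ((n : ℝ) + 2 * s))⁻¹) := by
  have : Nonempty (Fin n) := ⟨⟨0, hn⟩⟩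
  rw [integrable_fun_norm_addHaar volume
    (f := fun r : ℝ => min (r ^ 2) 1 * (r ^ ((n : ℝ) + 2 * s))⁻¹)]
  have hpow : ∀ r : ℝ, 0 < r → r ^ (Module.finrank ℝ (Rn n) - 1) * (r ^ ((n : ℝ) + 2 * s))⁻¹ =
      r ^ (-1 - 2 * s) := by
    intro r hr
    rw [← Real.rpow_natCast, ← Real.rpow_neg hr.le, ← Real.rpow_add hr]
    congr 1
    rw [finrank_euclideanSpace_fin, Nat.cast_sub hn]
    push_cast
    ring
  rw [← Ioc_union_Ioi_eq_Ioi zero_le_one, integrableOn_union]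
  constructor
  · have h1 : IntegrableOn (fun r : ℝ => r ^ (1 - 2 * s)) (Ioc 0 1) :=
      (intervalIntegrable_iff_integrableOn_Ioc_of_le zero_le_one).1
        (intervalIntegral.intervalIntegrable_rpow' (by linarith))
    refine h1.congr_fun (fun r hr => ?_) measurableSet_Ioc
    have hr0 : 0 < r := hr.1
    have : min (r ^ 2) 1 = r ^ 2 := min_eq_left (by nlinarith [hr.2])
    simp only [smul_eq_mul, this]
    rw [mul_left_comm, hpow r hr0, ← Real.rpow_natCast, ← Real.rpow_add hr0]
    congr 1
    push_cast
    ring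
  · have h1 : IntegrableOn (fun r : ℝ => r ^ (-1 - 2 * s)) (Ioi 1) :=
      integrableOn_Ioi_rpow_of_lt (by linarith) zero_lt_one
    refine h1.congr_fun (fun r hr => ?_) measurableSet_Ioi
    have hr1 : 1 < r := hr
    have : min (r ^ 2) 1 = 1 := min_eq_right (by nlinarith)
    simp only [smul_eq_mul, this, one_mul]
    exact (hpow r (by linarith)).symm

/-- The derivative of `k ↦ φ (x + k) + φ (x - k)` is `Dφ (x + k) - Dφ (x - k)`, of norm at most `2 L
‖k‖` for a Lipschitz constant `L` of `Dφ`. The mean value inequality gives the quadratic bound, and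
the supremum of `|φ|` gives the constant one. -/
theorem exists_second_difference_bound {φ : Rn n → ℝ} (hφ : ContDiff ℝ 2 φ)
    (hc : HasCompactSupport φ) :
    ∃ M : ℝ, 0 ≤ M ∧ ∀ x h, |2 * φ x - φ (x + h) - φ (x - h)| ≤ M * min (‖h‖ ^ 2) 1 := by
  obtain ⟨A, hA⟩ := hφ.continuous.bounded_above_of_compact_support hc
  obtain ⟨L, hL⟩ := (hφ.fderiv_right (m := 1) (by norm_num)).lipschitzWith_of_hasCompactSupport
    (hc.fderiv ℝ) one_ne_zero
  have hA0 : 0 ≤ A := (norm_nonneg _).trans (hA 0)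
  refine ⟨4 * A + 2 * L, by positivity, fun x h => ?_⟩
  have h1 : |2 * φ x - φ (x + h) - φ (x - h)| ≤ 4 * A := by
    have a := abs_le.1 (hA x)
    have b := abs_le.1 (hA (x + h))
    have c := abs_le.1 (hA (x - h))
    rw [abs_le]
    constructor <;> linarith [a.1, a.2, b.1, b.2, c.1, c.2]
  have h2 : |2 * φ x - φ (x + h) - φ (x - h)| ≤ 2 * L * ‖h‖ ^ 2 := by
    have hd : Differentiable ℝ φ := hφ.differentiable (by norm_num)
    have key := (convex_closedBall (0 : Rn n) ‖h‖).norm_image_sub_le_of_norm_hasFDerivWithin_le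
      (f := fun k => φ (x + k) + φ (x - k)) (f' := fun k => fderiv ℝ φ (x + k) - fderiv ℝ φ (x - k))
      (C := 2 * L * ‖h‖) (x := 0) (y := h) ?_ ?_ (by simp) (by simp)
    · simp only [add_zero, sub_zero, Real.norm_eq_abs] at key
      rw [abs_sub_comm] at key
      calc _ = |φ x + φ x - (φ (x + h) + φ (x - h))| := by congr 1; ring
        _ ≤ _ := key
        _ = _ := by ring
    · intro k _
      have e1 : HasFDerivAt (fun k => φ (x + k)) (fderiv ℝ φ (x + k)) k := by
        have := (hd (x + k)).hasFDerivAt.comp k ((hasFDerivAt_id k).const_add x)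
        rwa [ContinuousLinearMap.comp_id] at this
      have e2 : HasFDerivAt (fun k => φ (x - k)) (-fderiv ℝ φ (x - k)) k := by
        have := (hd (x - k)).hasFDerivAt.comp k ((hasFDerivAt_id k).const_sub x)
        rwa [ContinuousLinearMap.comp_neg, ContinuousLinearMap.comp_id] at this
      rw [sub_eq_add_neg]
      exact (e1.add e2).hasFDerivWithinAt
    · intro k hk
      rw [mem_closedBall_zero_iff] at hk
      have := hL.dist_le_mul (x + k) (x - k)
      rw [dist_eq_norm, dist_eq_norm] at this
      have e : x + k - (x - k) = (2 : ℝ) • k := by rw [two_smul]; abel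
      rw [e, norm_smul, Real.norm_two] at this
      refine this.trans ?_
      have hL0 : (0 : ℝ) ≤ L := L.2
      nlinarith
  rcases min_choice (‖h‖ ^ 2) 1 with e | e <;> rw [e]
  · have : 0 ≤ A * ‖h‖ ^ 2 := by positivity
    linarith
  · simp only [mul_one]
    have : (0 : ℝ) ≤ L := L.2
    linarith

theorem kern_le_rpow_neg (p η : ℝ) (h : Rn n) : kern p η h ≤ (‖h‖ ^ p)⁻¹ :=
  indicator_le_self' (fun _ _ => by positivity) h

/-- The kernel is even, so averaging the integrand over `h` and `-h` cancels the first-order part of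
`φ`. The result is absolutely integrable uniformly in `η`. -/
theorem fracTrunc_eq_second_difference {s η : ℝ} (hs : 0 < s) (hη : 0 < η) {φ : Rn n → ℝ}
    (hφ : Continuous φ) (hc : HasCompactSupport φ) (x : Rn n) :
    fracTrunc s φ x η =
      ∫ h, (2 * φ x - φ (x + h) - φ (x - h)) / 2 * kern ((n : ℝ) + 2 * s) η h := by
  have hp : (n : ℝ) < (n : ℝ) + 2 * s := by linarith
  have hk := integrable_kern hp hη
  obtain ⟨A, hA⟩ := hφ.bounded_above_of_compact_support hc
  have hb : ∀ g : Rn n → Rn n, Continuous g →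
      Integrable (fun h => (φ x - φ (g h)) * kern ((n : ℝ) + 2 * s) η h) := by
    intro g hg
    refine hk.bdd_mul (c := A + A) (by fun_prop) (Eventually.of_forall fun h => ?_)
    exact (norm_sub_le _ _).trans (add_le_add (hA _) (hA _))
  have e1 : fracTrunc s φ x η = ∫ h, (φ x - φ (x - h)) * kern ((n : ℝ) + 2 * s) η h := by
    rw [fracTrunc_eq_integral, ← integral_sub_left_eq_self _ volume x]
    simp
  have e2 : fracTrunc s φ x η = ∫ h, (φ x - φ (x + h)) * kern ((n : ℝ) + 2 * s) η h := by
    rw [e1, ← integral_neg_eq_self]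
    simp [kern_neg]
  have e3 : fracTrunc s φ x η = (fracTrunc s φ x η + fracTrunc s φ x η) / 2 := by ring
  rw [e3]
  nth_rewrite 1 [e1]
  rw [e2, ← integral_add (hb _ (by fun_prop)) (hb _ (by fun_prop)), ← integral_div]
  congr 1
  ext h
  ring

/-- Shows that `limUnder` in the definition of the fractional Laplacian is a genuine limit on test
functions: the second-difference form is dominated by an integrable function independent of `η`. -/
theorem tendsto_fracTrunc (hn : 1 ≤ n) {s : ℝ} (hs0 : 0 < s) (hs1 : s < 1) {φ : Rn n → ℝ}
    (hφ : ContDiff ℝ 2 φ) (hc : HasCompactSupport φ) (x : Rn n) :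
    Tendsto (fracTrunc s φ x) (𝓝[>] 0) (𝓝 (limUnder (𝓝[>] (0 : ℝ)) (fracTrunc s φ x))) := by
  refine tendsto_nhds_limUnder ⟨∫ h, (2 * φ x - φ (x + h) - φ (x - h)) / 2 *
    (‖h‖ ^ ((n : ℝ) + 2 * s))⁻¹, ?_⟩
  obtain ⟨M, hM0, hM⟩ := exists_second_difference_bound hφ hc
  have hcont := hφ.continuous
  have key : Tendsto (fun η => ∫ h, (2 * φ x - φ (x + h) - φ (x - h)) / 2 *
      kern ((n : ℝ) + 2 * s) η h) (𝓝[>] 0) (𝓝 (∫ h, (2 * φ x - φ (x + h) - φ (x - h)) / 2 *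
    (‖h‖ ^ ((n : ℝ) + 2 * s))⁻¹)) := by
    refine tendsto_integral_filter_of_dominated_convergence
      (fun h => M * (min (‖h‖ ^ 2) 1 * (‖h‖ ^ ((n : ℝ) + 2 * s))⁻¹)) ?_ ?_
      ((integrable_min_sq_mul_rpow_neg hn hs0 hs1).const_mul M) ?_
    · exact Eventually.of_forall fun η =>
        (Continuous.aestronglyMeasurable (by fun_prop)).mul
          (measurable_kern _ η).aestronglyMeasurable
    · refine Eventually.of_forall fun η => Eventually.of_forall fun h => ?_
      have h1 := hM x h
      have h2 := kern_le_rpow_neg ((n : ℝ) + 2 * s) η h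
      have h3 := kern_nonneg ((n : ℝ) + 2 * s) η h
      rw [norm_mul, Real.norm_of_nonneg h3, Real.norm_eq_abs, abs_div, abs_two, ← mul_assoc]
      have h4 := abs_nonneg (2 * φ x - φ (x + h) - φ (x - h))
      exact mul_le_mul (by linarith) h2 h3 (h4.trans h1)
    · refine Eventually.of_forall fun h => ?_
      rcases eq_or_ne h 0 with rfl | hh
      · have : 2 * φ x - φ (x + 0) - φ (x - 0) = 0 := by simp; ring
        simp only [this, zero_div, zero_mul, tendsto_const_nhds]
      · refine tendsto_const_nhds.congr' ?_
        have : ∀ᶠ η in 𝓝[>] (0 : ℝ), η < ‖h‖ :=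
          (eventually_lt_nhds (norm_pos_iff.2 hh)).filter_mono nhdsWithin_le_nhds
        filter_upwards [this] with η hη
        rw [kern, indicator_of_mem (by exact hη)]
  refine key.congr' ?_
  filter_upwards [self_mem_nhdsWithin] with η hη
  exact (fracTrunc_eq_second_difference hs0 hη hcont hc x).symm

theorem exists_le_wt_of_hasCompactSupport {p : ℝ} {q : Rn n → ℝ} {A : ℝ} (hp : 0 ≤ p)
    (hA : ∀ x, |q x| ≤ A) (hc : HasCompactSupport q) :
    ∃ C : ℝ, 0 ≤ C ∧ ∀ x, |q x| ≤ C * wt p x := by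
  obtain ⟨R, hR⟩ := hc.isCompact.isBounded.exists_norm_le
  have hA0 : 0 ≤ A := (abs_nonneg _).trans (hA 0)
  refine ⟨A * (1 + |R| ^ p), by positivity, fun x => ?_⟩
  by_cases hx : x ∈ tsupport q
  · have h1 : ‖x‖ ≤ |R| := (hR x hx).trans (le_abs_self R)
    have h2 : 1 ≤ (1 + |R| ^ p) * wt p x := by
      rw [wt, ← div_eq_mul_inv, one_le_div (by positivity)]
      gcongr
    calc |q x| ≤ A * 1 := by simpa using hA x
      _ ≤ A * ((1 + |R| ^ p) * wt p x) := by gcongr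
      _ = _ := by ring
  · rw [image_eq_zero_of_notMem_tsupport hx, abs_zero]
    have := wt_pos p x
    positivity

/-- For bounded `x` the second-difference bound suffices. Far from the support `φ x = 0`, and only
`∫ |φ|` against a kernel of size about `‖x‖^(-p)` is left. Uniformity in `η` is what allows `η → 0`
under the integral against a function of the weighted class. -/
theorem exists_fracTrunc_le (hn : 1 ≤ n) {s : ℝ} (hs0 : 0 < s) (hs1 : s < 1) {φ : Rn n → ℝ}
    (hφ : ContDiff ℝ 2 φ) (hc : HasCompactSupport φ) :
    ∃ C : ℝ, 0 ≤ C ∧ ∀ η, 0 < η → ∀ x, |fracTrunc s φ x η| ≤ C * wt ((n : ℝ) + 2 * s) x := by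
  set p : ℝ := (n : ℝ) + 2 * s with hp
  have hp0 : 0 ≤ p := by positivity
  obtain ⟨M, hM0, hM⟩ := exists_second_difference_bound hφ hc
  have hint : Integrable φ := hφ.continuous.integrable_of_hasCompactSupport hc
  set I : ℝ := ∫ h : Rn n, min (‖h‖ ^ 2) 1 * (‖h‖ ^ p)⁻¹ with hI
  have hI0 : 0 ≤ I := integral_nonneg fun h => by positivity
  have h1 : ∀ η, 0 < η → ∀ x, |fracTrunc s φ x η| ≤ M * I := by
    intro η hη x
    rw [fracTrunc_eq_second_difference hs0 hη hφ.continuous hc, ← Real.norm_eq_abs, hI,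
      ← integral_const_mul]
    refine norm_integral_le_of_norm_le
      ((integrable_min_sq_mul_rpow_neg hn hs0 hs1).const_mul M) (Eventually.of_forall fun h => ?_)
    have h1 := hM x h
    have h2 := kern_le_rpow_neg p η h
    have h3 := kern_nonneg p η h
    rw [norm_mul, Real.norm_of_nonneg h3, Real.norm_eq_abs, abs_div, abs_two, ← mul_assoc]
    have h4 := abs_nonneg (2 * φ x - φ (x + h) - φ (x - h))
    exact mul_le_mul (by linarith) h2 h3 (h4.trans h1)
  obtain ⟨R, hR⟩ := hc.isCompact.isBounded.exists_norm_le
  set N : ℝ := ∫ y, |φ y| with hN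
  have hN0 : 0 ≤ N := integral_nonneg fun h => abs_nonneg _
  -- Beyond `S`, the bound `‖x‖ > 1` makes `‖x‖^(-p)` comparable to the weight, and `‖x‖ > 2 |R|`
  -- gives `‖x - y‖ ≥ ‖x‖ / 2` for `y` in the support.
  set S : ℝ := max 1 (2 * |R|) with hS
  have hS1 : 1 ≤ S := le_max_left _ _
  have hS2 : 2 * |R| ≤ S := le_max_right _ _
  clear_value I N S
  refine ⟨M * I * (1 + S ^ p) + 2 * 2 ^ p * N, by positivity, fun η hη x => ?_⟩
  have hw := wt_pos p x
  by_cases hx : ‖x‖ ≤ S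
  · have h2 : 1 ≤ (1 + S ^ p) * wt p x := by
      rw [wt, ← div_eq_mul_inv, one_le_div (by positivity)]
      gcongr
    calc |fracTrunc s φ x η| ≤ M * I * 1 := by simpa using h1 η hη x
      _ ≤ M * I * ((1 + S ^ p) * wt p x) := by gcongr
      _ ≤ M * I * ((1 + S ^ p) * wt p x) + 2 * 2 ^ p * N * wt p x :=
        le_add_of_nonneg_right (by positivity)
      _ = _ := by ring
  · push Not at hx
    have hx1 : 1 < ‖x‖ := hS1.trans_lt hx
    have hxR : 2 * |R| < ‖x‖ := hS2.trans_lt hx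
    have hx0 : φ x = 0 := by
      refine image_eq_zero_of_notMem_tsupport fun hmem => ?_
      have := hR x hmem
      linarith [le_abs_self R, abs_nonneg R]
    have hwx : (‖x‖ ^ p)⁻¹ ≤ 2 * wt p x := by
      have : 1 ≤ ‖x‖ ^ p := Real.one_le_rpow hx1.le hp0
      rw [wt, ← div_eq_mul_inv, inv_le_comm₀ (by positivity) (by positivity), inv_div,
        div_le_iff₀ (by positivity)]
      linarith
    have h3 : |fracTrunc s φ x η| ≤ ∫ y, |φ y| * (2 ^ p * (2 * wt p x)) := by
      rw [fracTrunc_eq_integral, ← Real.norm_eq_abs]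
      refine norm_integral_le_of_norm_le (hint.abs.mul_const _) (Eventually.of_forall fun y => ?_)
      rw [norm_mul, Real.norm_of_nonneg (kern_nonneg _ _ _), hx0, zero_sub, norm_neg,
        Real.norm_eq_abs]
      by_cases hy : y ∈ tsupport φ
      · gcongr
        refine (kern_le_rpow_neg _ _ _).trans ?_
        have hyR := (hR y hy).trans (le_abs_self R)
        have h5 : ‖x‖ / 2 ≤ ‖x - y‖ := by
          have := norm_sub_norm_le x y
          linarith
        calc (‖x - y‖ ^ p)⁻¹ ≤ ((‖x‖ / 2) ^ p)⁻¹ := by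
              gcongr
          _ = 2 ^ p * (‖x‖ ^ p)⁻¹ := by
              rw [Real.div_rpow (norm_nonneg _) zero_le_two, inv_div, div_eq_mul_inv]
          _ ≤ _ := by gcongr
      · rw [image_eq_zero_of_notMem_tsupport hy]
        simp
    rw [integral_mul_const] at h3
    calc _ ≤ _ := h3
      _ = 2 * 2 ^ p * N * wt p x := by rw [hN]; ring
      _ ≤ M * I * (1 + S ^ p) * wt p x + 2 * 2 ^ p * N * wt p x :=
        le_add_of_nonneg_left (by positivity)
      _ = _ := by ring

theorem fracConst_nonneg {s : ℝ} (hs0 : 0 < s) (hs1 : s < 1) : 0 ≤ fracConst n s := by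
  have h1 : 0 < Real.Gamma ((n : ℝ) / 2 + s) := Real.Gamma_pos_of_pos (by positivity)
  have h2 : 0 < Real.Gamma (1 - s) := Real.Gamma_pos_of_pos (by linarith)
  unfold fracConst
  positivity

theorem measurable_cv {k u : Rn n → ℝ} (hk : Measurable k) (hu : Measurable u) :
    Measurable (cv k u) := by
  have : StronglyMeasurable (fun z : Rn n × Rn n => u z.2 * k (z.1 - z.2)) :=
    ((hu.comp measurable_snd).mul
      (hk.comp (measurable_fst.sub measurable_snd))).stronglyMeasurable
  exact this.integral_prod_right.measurable

theorem measurable_limUnder_fracTrunc (hn : 1 ≤ n) {s : ℝ} (hs0 : 0 < s) (hs1 : s < 1)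
    {φ : Rn n → ℝ} (hφ : ContDiff ℝ 2 φ) (hc : HasCompactSupport φ) :
    Measurable (fun x => limUnder (𝓝[>] (0 : ℝ)) (fracTrunc s φ x)) := by
  have hint : Integrable φ := hφ.continuous.integrable_of_hasCompactSupport hc
  have hm := hφ.continuous.measurable
  refine measurable_of_tendsto_metrizable
    (f := fun (i : ℕ) x => fracTrunc s φ x (1 / ((i : ℝ) + 1))) (fun i => ?_) ?_
  · have : (fun x => fracTrunc s φ x (1 / ((i : ℝ) + 1))) = fun x =>
        (∫ y : Rn n, kern ((n : ℝ) + 2 * s) (1 / ((i : ℝ) + 1)) y) * φ x -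
          cv (kern ((n : ℝ) + 2 * s) (1 / ((i : ℝ) + 1))) φ x := by
      ext x
      exact fracTrunc_eq_sub hs0 (by positivity) hm hint x
    rw [this]
    exact (hm.const_mul _).sub (measurable_cv (measurable_kern _ _) hm)
  · rw [tendsto_pi_nhds]
    intro x
    refine (tendsto_fracTrunc hn hs0 hs1 hφ hc x).comp ?_
    exact tendsto_nhdsWithin_iff.2 ⟨tendsto_one_div_add_atTop_nhds_zero_nat,
      Eventually.of_forall fun i => by simp only [mem_Ioi]; positivity⟩

theorem measurable_fracLaplacian (hn : 1 ≤ n) {s : ℝ} (hs0 : 0 < s) (hs1 : s < 1)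
    {φ : Rn n → ℝ} (hφ : ContDiff ℝ 2 φ) (hc : HasCompactSupport φ) :
    Measurable (fracLaplacian s φ) :=
  (measurable_limUnder_fracTrunc hn hs0 hs1 hφ hc).const_mul _

theorem exists_fracLaplacian_le (hn : 1 ≤ n) {s : ℝ} (hs0 : 0 < s) (hs1 : s < 1) {φ : Rn n → ℝ}
    (hφ : ContDiff ℝ 2 φ) (hc : HasCompactSupport φ) :
    ∃ C : ℝ, 0 ≤ C ∧ ∀ x, |fracLaplacian s φ x| ≤ C * wt ((n : ℝ) + 2 * s) x := by
  obtain ⟨C, hC0, hC⟩ := exists_fracTrunc_le hn hs0 hs1 hφ hc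
  have h0 := fracConst_nonneg (n := n) hs0 hs1
  refine ⟨fracConst n s * C, by positivity, fun x => ?_⟩
  rw [fracLaplacian, abs_mul, abs_of_nonneg h0, mul_assoc]
  gcongr
  refine le_of_tendsto (tendsto_fracTrunc hn hs0 hs1 hφ hc x).abs ?_
  filter_upwards [self_mem_nhdsWithin] with η hη using hC η hη x

theorem tendsto_integral_mul_fracTrunc (hn : 1 ≤ n) {s : ℝ} (hs0 : 0 < s) (hs1 : s < 1)
    {φ : Rn n → ℝ} (hφ : ContDiff ℝ 2 φ) (hc : HasCompactSupport φ) {u : Rn n → ℝ}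
    (hum : Measurable u) (hu : Integrable (fun x => u x * wt ((n : ℝ) + 2 * s) x)) :
    Tendsto (fun η => fracConst n s * ∫ x, u x * fracTrunc s φ x η) (𝓝[>] 0)
      (𝓝 (∫ x, u x * fracLaplacian s φ x)) := by
  obtain ⟨C, hC0, hC⟩ := exists_fracTrunc_le hn hs0 hs1 hφ hc
  have hint : Integrable φ := hφ.continuous.integrable_of_hasCompactSupport hc
  have hm := hφ.continuous.measurable
  have e : ∫ x, u x * fracLaplacian s φ x =
      fracConst n s * ∫ x, u x * limUnder (𝓝[>] (0 : ℝ)) (fracTrunc s φ x) := by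
    rw [← integral_const_mul]
    congr 1
    ext x
    rw [fracLaplacian]
    ring
  rw [e]
  refine Tendsto.const_mul _ ?_
  refine tendsto_integral_filter_of_dominated_convergence
    (fun x => C * ‖u x * wt ((n : ℝ) + 2 * s) x‖) ?_ ?_ (hu.norm.const_mul C) ?_
  · filter_upwards [self_mem_nhdsWithin] with η hη
    have : (fun x => fracTrunc s φ x η) = fun x =>
        (∫ y : Rn n, kern ((n : ℝ) + 2 * s) η y) * φ x - cv (kern ((n : ℝ) + 2 * s) η) φ x := by
      ext x
      exact fracTrunc_eq_sub hs0 hη hm hint x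
    have hT : Measurable (fun x => fracTrunc s φ x η) := by
      rw [this]
      exact (hm.const_mul _).sub (measurable_cv (measurable_kern _ _) hm)
    exact (hum.mul hT).aestronglyMeasurable
  · filter_upwards [self_mem_nhdsWithin] with η hη
    refine Eventually.of_forall fun x => ?_
    rw [norm_mul, norm_mul, Real.norm_of_nonneg (wt_pos _ _).le, mul_left_comm]
    gcongr
    exact hC η hη x
  · exact Eventually.of_forall fun x => (tendsto_fracTrunc hn hs0 hs1 hφ hc x).const_mul _

/-! ### Mollifiers on the weighted space -/

/-- A smooth even probability density supported in the closed ball of radius `ε`. -/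
structure IsMollifier (ρ : Rn n → ℝ) (ε : ℝ) : Prop where
  contDiff : ContDiff ℝ (⊤ : ℕ∞) ρ
  nonneg : ∀ x, 0 ≤ ρ x
  even : ∀ x, ρ (-x) = ρ x
  integral_eq_one : ∫ x, ρ x = 1
  eq_zero : ∀ x, ε < ‖x‖ → ρ x = 0

namespace IsMollifier

variable {ρ : Rn n → ℝ} {ε : ℝ}

theorem continuous (h : IsMollifier ρ ε) : Continuous ρ := h.contDiff.continuous

theorem measurable (h : IsMollifier ρ ε) : Measurable ρ := h.continuous.measurable

theorem tsupport_subset (h : IsMollifier ρ ε) : tsupport ρ ⊆ Metric.closedBall 0 ε := by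
  refine closure_minimal (fun x hx => ?_) Metric.isClosed_closedBall
  rw [mem_closedBall_zero_iff]
  by_contra hlt
  exact hx (h.eq_zero x (not_le.1 hlt))

theorem hasCompactSupport (h : IsMollifier ρ ε) : HasCompactSupport ρ :=
  (isCompact_closedBall 0 ε).of_isClosed_subset (isClosed_tsupport _) h.tsupport_subset

theorem integrable (h : IsMollifier ρ ε) : Integrable ρ :=
  h.continuous.integrable_of_hasCompactSupport h.hasCompactSupport

theorem sub_comm (h : IsMollifier ρ ε) (x y : Rn n) : ρ (x - y) = ρ (y - x) := by
  rw [← h.even, neg_sub]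

theorem exists_le (h : IsMollifier ρ ε) : ∃ A, ∀ x, |ρ x| ≤ A :=
  h.continuous.bounded_above_of_compact_support h.hasCompactSupport

/-- The mollifier only sees `‖x - y‖ ≤ ε ≤ 1`, where the weights at `x` and `y` are comparable. -/
theorem mul_wt_le (h : IsMollifier ρ ε) (hε : ε ≤ 1) {p : ℝ} (hp : 0 ≤ p) (x y : Rn n) :
    ρ (x - y) * wt p y ≤ ρ (x - y) * ((1 + 2 ^ p) * wt p x) := by
  rcases lt_or_ge ε ‖x - y‖ with hlt | hle
  · simp [h.eq_zero _ hlt]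
  · gcongr
    · exact h.nonneg _
    · have := wt_sub_le hp zero_le_one (x := x) (h := x - y) (hle.trans hε)
      rwa [sub_sub_cancel, one_add_one_eq_two] at this

/-- The basic Fubini hypothesis: once the weight is transferred from `y` to `x`, integrating in `y`
only uses that `ρ` has mass one. -/
theorem integrable_prod_mul_wt (h : IsMollifier ρ ε) (hε : ε ≤ 1) {p : ℝ} (hp : 0 ≤ p)
    {u : Rn n → ℝ} (hum : Measurable u) (hu : Integrable (fun x => u x * wt p x)) :
    Integrable (fun z : Rn n × Rn n => u z.1 * (wt p z.2 * ρ (z.1 - z.2)))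
      (volume.prod volume) := by
  have hm : Measurable (fun z : Rn n × Rn n => u z.1 * (wt p z.2 * ρ (z.1 - z.2))) :=
    (hum.comp measurable_fst).mul (((continuous_wt hp).measurable.comp measurable_snd).mul
      (h.measurable.comp (measurable_fst.sub measurable_snd)))
  have hle : ∀ x y, ‖u x * (wt p y * ρ (x - y))‖ ≤ (1 + 2 ^ p) * ‖u x * wt p x‖ * ρ (x - y) := by
    intro x y
    rw [norm_mul (u x) (wt p y * _), norm_mul (u x) (wt p x),
      Real.norm_of_nonneg (mul_nonneg (wt_pos p y).le (h.nonneg _)), Real.norm_of_nonneg (wt_pos p x).le, mul_comm (wt p y)]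
    calc _ ≤ ‖u x‖ * (ρ (x - y) * ((1 + 2 ^ p) * wt p x)) := by
          gcongr ?_ * ?_
          exact h.mul_wt_le hε hp x y
      _ = _ := by ring
  have hρ : ∀ x, Integrable (fun y => (1 + 2 ^ p) * ‖u x * wt p x‖ * ρ (x - y)) :=
    fun x => (h.integrable.comp_sub_left x).const_mul _
  rw [integrable_prod_iff hm.aestronglyMeasurable]
  refine ⟨Eventually.of_forall fun x => ?_, ?_⟩
  · exact (hρ x).mono' (hm.comp measurable_prodMk_left).aestronglyMeasurable
      (Eventually.of_forall fun y => hle x y)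
  · refine (hu.norm.const_mul (1 + 2 ^ p)).mono'
      hm.norm.stronglyMeasurable.integral_prod_right.aestronglyMeasurable
      (Eventually.of_forall fun x => ?_)
    rw [Real.norm_of_nonneg (integral_nonneg fun y => norm_nonneg _)]
    calc _ ≤ ∫ y, (1 + 2 ^ p) * ‖u x * wt p x‖ * ρ (x - y) :=
          integral_mono_of_nonneg (Eventually.of_forall fun y => norm_nonneg _) (hρ x)
            (Eventually.of_forall fun y => hle x y)
      _ = _ := by
          rw [integral_const_mul, integral_sub_left_eq_self, h.integral_eq_one, mul_one]

theorem integrable_prod_of_le_wt (h : IsMollifier ρ ε) (hε : ε ≤ 1) {p : ℝ} (hp : 0 ≤ p)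
    {u g : Rn n → ℝ} (hum : Measurable u) (hu : Integrable (fun x => u x * wt p x))
    (hgm : Measurable g) {C : ℝ} (hg : ∀ x, |g x| ≤ C * wt p x) :
    Integrable (fun z : Rn n × Rn n => u z.1 * (g z.2 * ρ (z.1 - z.2))) (volume.prod volume) := by
  refine ((h.integrable_prod_mul_wt hε hp hum hu).norm.const_mul C).mono' ?_
    (Eventually.of_forall fun z => ?_)
  · exact ((hum.comp measurable_fst).mul ((hgm.comp measurable_snd).mul
      (h.measurable.comp (measurable_fst.sub measurable_snd)))).aestronglyMeasurable
  · simp only [norm_mul, Real.norm_of_nonneg (h.nonneg _), Real.norm_of_nonneg (wt_pos p _).le]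
    have h1 := hg z.2
    have h2 := h.nonneg (z.1 - z.2)
    calc _ ≤ ‖u z.1‖ * (C * wt p z.2 * ρ (z.1 - z.2)) := by gcongr; exact h1
      _ = _ := by ring

theorem integrable_cv_mul_wt (h : IsMollifier ρ ε) (hε : ε ≤ 1) {p : ℝ} (hp : 0 ≤ p)
    {u : Rn n → ℝ} (hum : Measurable u) (hu : Integrable (fun x => u x * wt p x)) :
    Integrable (fun x => cv ρ u x * wt p x) := by
  refine (h.integrable_prod_mul_wt hε hp hum hu).integral_prod_right.congr
    (Eventually.of_forall fun y => ?_)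
  simp only [cv]
  rw [← integral_mul_const]
  congr 1
  ext x
  rw [h.sub_comm y x]
  ring

theorem contDiff_cv (h : IsMollifier ρ ε) {u : Rn n → ℝ} (hu : LocallyIntegrable u) :
    ContDiff ℝ (⊤ : ℕ∞) (cv ρ u) :=
  h.hasCompactSupport.contDiff_convolution_right (ContinuousLinearMap.mul ℝ ℝ) hu h.contDiff

theorem support_cv_subset (h : IsMollifier ρ ε) {q : Rn n → ℝ} :
    Function.support (cv ρ q) ⊆ Metric.cthickening ε (tsupport q) := by
  intro x hx
  by_contra hcon
  refine hx ?_
  refine integral_eq_zero_of_ae (Eventually.of_forall fun y => ?_)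
  by_cases hy : y ∈ tsupport q
  · have : ε < ‖x - y‖ := by
      by_contra hle
      refine hcon (Metric.mem_cthickening_of_dist_le x y ε _ hy ?_)
      rw [dist_eq_norm]
      exact not_lt.1 hle
    simp [h.eq_zero _ this]
  · simp [image_eq_zero_of_notMem_tsupport hy]

theorem tsupport_cv_subset (h : IsMollifier ρ ε) {q : Rn n → ℝ} :
    tsupport (cv ρ q) ⊆ Metric.cthickening ε (tsupport q) :=
  closure_minimal h.support_cv_subset Metric.isClosed_cthickening

theorem hasCompactSupport_cv (h : IsMollifier ρ ε) {q : Rn n → ℝ} (hq : HasCompactSupport q) :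
    HasCompactSupport (cv ρ q) :=
  hq.isCompact.cthickening.of_isClosed_subset (isClosed_tsupport _) h.tsupport_cv_subset

theorem cv_nonneg (h : IsMollifier ρ ε) {q : Rn n → ℝ} (hq : ∀ x, 0 ≤ q x) (x : Rn n) :
    0 ≤ cv ρ q x :=
  integral_nonneg fun y => mul_nonneg (hq y) (h.nonneg _)

end IsMollifier

/-! ### Symmetry and commutation of convolutions -/

theorem integral_mul_cv_eq {k u g : Rn n → ℝ} (hk : ∀ x, k (-x) = k x)
    (h : Integrable (fun z : Rn n × Rn n => u z.1 * (g z.2 * k (z.1 - z.2)))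
      (volume.prod volume)) :
    ∫ x, u x * cv k g x = ∫ x, g x * cv k u x := by
  simp only [cv, ← integral_const_mul]
  rw [integral_integral_swap h]
  congr 1
  ext y
  congr 1
  ext x
  rw [← hk (x - y), neg_sub]
  ring

theorem integrable_of_bounded_of_hasCompactSupport {q : Rn n → ℝ} (hqm : Measurable q) {A : ℝ}
    (hA : ∀ x, |q x| ≤ A) (hc : HasCompactSupport q) : Integrable q := by
  have h : IntegrableOn q (tsupport q) :=
    Measure.integrableOn_of_bounded (M := A) hc.isCompact.measure_lt_top.ne
      hqm.aestronglyMeasurable (Eventually.of_forall hA)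
  exact (integrableOn_iff_integrable_of_support_subset (subset_tsupport q)).1 h

/-- After Fubini on both sides, the reflection `y ↦ x + z - y` exchanges `x - y` and `y - z`. -/
theorem cv_comm_of_bounded {k l q : Rn n → ℝ} (hkm : Measurable k) (hlm : Measurable l)
    (hqm : Measurable q) (hk : Integrable k) (hl : Integrable l) (hq : Integrable q)
    {A B : ℝ} (hA : ∀ x, |k x| ≤ A) (hB : ∀ x, |l x| ≤ B) (x : Rn n) :
    cv k (cv l q) x = cv l (cv k q) x := by
  have aux : ∀ {k l : Rn n → ℝ} {B : ℝ}, Measurable k → Measurable l → Integrable k →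
      (∀ x, |l x| ≤ B) → Integrable (fun z : Rn n × Rn n => q z.2 * l (z.1 - z.2) * k (x - z.1))
        (volume.prod volume) := by
    intro k l B hkm hlm hk hB
    refine (((hk.comp_sub_left x).mul_prod hq).norm.const_mul B).mono' ?_
      (Eventually.of_forall fun z => ?_)
    · exact (((hqm.comp measurable_snd).mul (hlm.comp (measurable_fst.sub measurable_snd))).mul
        (hkm.comp (measurable_const.sub measurable_fst))).aestronglyMeasurable
    · simp only [norm_mul]
      have := hB (z.1 - z.2)
      rw [← Real.norm_eq_abs] at this
      calc _ ≤ ‖q z.2‖ * B * ‖k (x - z.1)‖ := by gcongr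
        _ = _ := by ring
  simp only [cv, ← integral_mul_const]
  refine (integral_integral_swap (aux hkm hlm hk hB)).trans
    (Eq.trans ?_ (integral_integral_swap (aux hlm hkm hl hA)).symm)
  congr 1
  ext z
  rw [← integral_sub_left_eq_self _ volume (x + z)]
  congr 1
  ext y
  have e1 : x + z - y - z = x - y := by abel
  have e2 : x - (x + z - y) = y - z := by abel
  rw [e1, e2]
  ring

theorem kern_bounded {p η : ℝ} (hp : 0 ≤ p) (hη : 0 < η) (x : Rn n) :
    |kern p η x| ≤ 1 + (η ^ p)⁻¹ := by
  rw [abs_of_nonneg (kern_nonneg _ _ _)]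
  refine (kern_le hp hη x).trans ?_
  have := wt_le_one p x
  have h2 : 0 ≤ 1 + (η ^ p)⁻¹ := by positivity
  nlinarith

theorem exists_cv_kern_le {p η : ℝ} (hp : 0 ≤ p) (hη : 0 < η) {q : Rn n → ℝ}
    (hq : Integrable q) (hc : HasCompactSupport q) :
    ∃ C : ℝ, ∀ x, |cv (kern p η) q x| ≤ C * wt p x := by
  obtain ⟨R, hR⟩ := hc.isCompact.isBounded.exists_norm_le
  refine ⟨(∫ y, |q y|) * ((1 + (η ^ p)⁻¹) * (1 + (1 + |R|) ^ p)), fun x => ?_⟩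
  rw [cv, ← Real.norm_eq_abs, mul_assoc, ← integral_mul_const]
  refine norm_integral_le_of_norm_le (hq.abs.mul_const _) (Eventually.of_forall fun y => ?_)
  rw [norm_mul, Real.norm_of_nonneg (kern_nonneg _ _ _), Real.norm_eq_abs]
  by_cases hy : y ∈ tsupport q
  · gcongr
    calc _ ≤ (1 + (η ^ p)⁻¹) * wt p (x - y) := kern_le hp hη _
      _ ≤ (1 + (η ^ p)⁻¹) * ((1 + (1 + |R|) ^ p) * wt p x) := by
          gcongr
          exact wt_sub_le hp (abs_nonneg _) ((hR y hy).trans (le_abs_self R))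
      _ = _ := by ring
  · simp [image_eq_zero_of_notMem_tsupport hy]

theorem integrable_prod_kern {p η : ℝ} (hp : 0 ≤ p) (hη : 0 < η) {q w : Rn n → ℝ}
    (hqm : Measurable q) (hq : Integrable q) (hc : HasCompactSupport q) (hwm : Measurable w)
    (hw : Integrable (fun x => w x * wt p x)) :
    Integrable (fun z : Rn n × Rn n => q z.1 * (w z.2 * kern p η (z.1 - z.2)))
      (volume.prod volume) := by
  obtain ⟨R, hR⟩ := hc.isCompact.isBounded.exists_norm_le
  refine ((hq.mul_prod hw).norm.const_mul ((1 + (η ^ p)⁻¹) * (1 + (1 + |R|) ^ p))).mono' ?_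
    (Eventually.of_forall fun z => ?_)
  · exact ((hqm.comp measurable_fst).mul ((hwm.comp measurable_snd).mul
      ((measurable_kern p η).comp (measurable_fst.sub measurable_snd)))).aestronglyMeasurable
  · simp only [norm_mul, Real.norm_of_nonneg (kern_nonneg _ _ _),
      Real.norm_of_nonneg (wt_pos p _).le]
    by_cases hz : z.1 ∈ tsupport q
    · calc _ ≤ ‖q z.1‖ * (‖w z.2‖ * ((1 + (η ^ p)⁻¹) * ((1 + (1 + |R|) ^ p) * wt p z.2))) := by
            gcongr
            refine (kern_le hp hη _).trans ?_
            gcongr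
            exact wt_sub_le' hp (abs_nonneg _) ((hR _ hz).trans (le_abs_self R))
        _ = _ := by ring
    · simp [image_eq_zero_of_notMem_tsupport hz]

section Truncated

variable {s η : ℝ} {q : Rn n → ℝ} {A : ℝ}

/-- The truncated operator commutes with convolution by `ρ`, and convolution by the even `ρ` is
symmetric. Only boundedness, measurability and compact support of `q` are needed, so `q` may be a
cut-off of a test function to an arbitrary measurable set; this is the reason for working at `η >
0`. -/
theorem integral_mul_fracTrunc_cv (hs : 0 < s) (hη : 0 < η) {ρ : Rn n → ℝ} {ε : ℝ}
    (hρ : IsMollifier ρ ε) (hε : ε ≤ 1) {u : Rn n → ℝ} (hum : Measurable u)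
    (hu : Integrable (fun x => u x * wt ((n : ℝ) + 2 * s) x))
    (hqm : Measurable q) (hA : ∀ x, |q x| ≤ A) (hc : HasCompactSupport q) :
    ∫ x, u x * fracTrunc s (cv ρ q) x η = ∫ x, cv ρ u x * fracTrunc s q x η := by
  set p : ℝ := (n : ℝ) + 2 * s with hpdef
  have hp : (n : ℝ) < p := by rw [hpdef]; linarith
  have hp0 : 0 ≤ p := by positivity
  have hq := integrable_of_bounded_of_hasCompactSupport hqm hA hc
  obtain ⟨B, hB⟩ := hρ.exists_le
  have hcvm : Measurable (cv ρ q) := measurable_cv hρ.measurable hqm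
  have hcv : Integrable (cv ρ q) :=
    (hρ.contDiff_cv hq.locallyIntegrable).continuous.integrable_of_hasCompactSupport
      (hρ.hasCompactSupport_cv hc)
  obtain ⟨C₁, hC₁⟩ := exists_cv_kern_le hp0 hη hq hc
  obtain ⟨C₂, hC₂0, hC₂⟩ := exists_le_wt_of_hasCompactSupport hp0 hA hc
  have hkq : Measurable (cv (kern p η) q) := measurable_cv (measurable_kern _ _) hqm
  set κ : ℝ := ∫ y : Rn n, kern p η y
  have hTq : ∀ x, fracTrunc s q x η = κ * q x - cv (kern p η) q x :=
    fun x => fracTrunc_eq_sub hs hη hqm hq x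
  have hTqm : Measurable (fun x => fracTrunc s q x η) := by
    simp_rw [hTq]
    exact (hqm.const_mul _).sub hkq
  have hTle : ∀ x, |fracTrunc s q x η| ≤ (|κ| * C₂ + C₁) * wt p x := by
    intro x
    rw [hTq]
    refine (abs_sub _ _).trans ?_
    rw [abs_mul, add_mul, mul_assoc]
    gcongr
    · exact hC₂ x
    · exact hC₁ x
  have hcomm : ∀ x, fracTrunc s (cv ρ q) x η = cv ρ (fun y => fracTrunc s q y η) x := by
    intro x
    have hi : ∀ {g : Rn n → ℝ} {C : ℝ}, Measurable g → (∀ x, |g x| ≤ C * wt p x) →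
        Integrable (fun y => g y * ρ (x - y)) := by
      intro g C hgm hg
      refine (hρ.integrable.comp_sub_left x).bdd_mul (c := |C|) hgm.aestronglyMeasurable
        (Eventually.of_forall fun y => (hg y).trans ?_)
      have h1 := wt_le_one p y
      have h2 := wt_pos p y
      have h3 := le_abs_self C
      nlinarith [abs_nonneg C]
    rw [fracTrunc_eq_sub hs hη hcvm hcv,
      cv_comm_of_bounded (measurable_kern _ _) hρ.measurable hqm (integrable_kern hp hη)
        hρ.integrable hq (kern_bounded hp0 hη) hB]
    have e : cv ρ (fun y => fracTrunc s q y η) x =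
        ∫ y, (κ * (q y * ρ (x - y)) - cv (kern p η) q y * ρ (x - y)) := by
      refine integral_congr_ae (Eventually.of_forall fun y => ?_)
      simp only [hTq]
      ring
    rw [e, integral_sub ((hi hqm hC₂).const_mul _) (hi hkq hC₁), integral_const_mul]
    rfl
  simp_rw [hcomm]
  rw [integral_mul_cv_eq hρ.even (hρ.integrable_prod_of_le_wt hε hp0 hum hu hTqm hTle)]
  simp_rw [mul_comm]

theorem integrable_mul_of_bounded_of_hasCompactSupport {u : Rn n → ℝ} (hu : LocallyIntegrable u)
    (hqm : Measurable q) (hA : ∀ x, |q x| ≤ A) (hc : HasCompactSupport q) :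
    Integrable (fun x => q x * u x) := by
  have h : IntegrableOn (fun x => q x * u x) (tsupport q) :=
    (hu.integrableOn_isCompact hc.isCompact).bdd_mul (c := A) hqm.aestronglyMeasurable
      (Eventually.of_forall hA)
  exact (integrableOn_iff_integrable_of_support_subset
    ((Function.support_mul_subset_left q u).trans (subset_tsupport q))).1 h

theorem integrable_mul_trunc (hs : 0 < s) (hη : 0 < η) {w : Rn n → ℝ} (hwm : Measurable w)
    (hw : Integrable (fun x => w x * wt ((n : ℝ) + 2 * s) x))
    (hqm : Measurable q) (hA : ∀ x, |q x| ≤ A) (hc : HasCompactSupport q) :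
    Integrable (fun x => q x * ((∫ y : Rn n, kern ((n : ℝ) + 2 * s) η y) * w x -
      cv (kern ((n : ℝ) + 2 * s) η) w x)) := by
  have hp0 : 0 ≤ (n : ℝ) + 2 * s := by positivity
  have hq := integrable_of_bounded_of_hasCompactSupport hqm hA hc
  have h1 := (integrable_mul_of_bounded_of_hasCompactSupport
    (locallyIntegrable_of_memL hp0 hw) hqm hA hc).const_mul
      (∫ y : Rn n, kern ((n : ℝ) + 2 * s) η y)
  have h2 := (integrable_prod_kern hp0 hη hqm hq hc hwm hw).integral_prod_left
  simp only [integral_const_mul] at h2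
  refine (h1.sub h2).congr (Eventually.of_forall fun x => ?_)
  simp only [Pi.sub_apply, cv]
  ring

/-- Symmetry of the truncated operator. On the right it acts on `w`, where signs can be compared
pointwise. -/
theorem integral_mul_fracTrunc_eq (hs : 0 < s) (hη : 0 < η) {w : Rn n → ℝ} (hwm : Measurable w)
    (hw : Integrable (fun x => w x * wt ((n : ℝ) + 2 * s) x))
    (hqm : Measurable q) (hA : ∀ x, |q x| ≤ A) (hc : HasCompactSupport q) :
    ∫ x, w x * fracTrunc s q x η =
      ∫ x, q x * ((∫ y : Rn n, kern ((n : ℝ) + 2 * s) η y) * w x -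
        cv (kern ((n : ℝ) + 2 * s) η) w x) := by
  have hp0 : 0 ≤ (n : ℝ) + 2 * s := by positivity
  have hq := integrable_of_bounded_of_hasCompactSupport hqm hA hc
  have hi := integrable_prod_kern hp0 hη hqm hq hc hwm hw
  have h1 := (integrable_mul_of_bounded_of_hasCompactSupport
    (locallyIntegrable_of_memL hp0 hw) hqm hA hc).const_mul
      (∫ y : Rn n, kern ((n : ℝ) + 2 * s) η y)
  have h2 := hi.integral_prod_left
  have h3 := hi.integral_prod_right
  have hpair := integral_mul_cv_eq (kern_neg _ _) hi
  simp only [integral_const_mul] at h2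
  change Integrable (fun x => q x * cv (kern ((n : ℝ) + 2 * s) η) w x) at h2
  have h4 : Integrable (fun x => w x * cv (kern ((n : ℝ) + 2 * s) η) q x) := by
    refine h3.congr (Eventually.of_forall fun y => ?_)
    simp only [cv, ← integral_const_mul]
    congr 1
    ext x
    rw [← kern_neg _ _ (x - y), neg_sub]
    ring
  calc ∫ x, w x * fracTrunc s q x η
      = ∫ x, ((∫ y : Rn n, kern ((n : ℝ) + 2 * s) η y) * (q x * w x) -
          w x * cv (kern ((n : ℝ) + 2 * s) η) q x) := by
        congr 1
        ext x
        rw [fracTrunc_eq_sub hs hη hqm hq]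
        ring
    _ = ∫ x, ((∫ y : Rn n, kern ((n : ℝ) + 2 * s) η y) * (q x * w x) -
          q x * cv (kern ((n : ℝ) + 2 * s) η) w x) := by
        rw [integral_sub h1 h4, ← hpair, integral_sub h1 h2]
    _ = _ := by
        congr 1
        ext x
        ring

end Truncated

/-! ### The nonlocal term of the maximum -/

theorem integrable_max_mul_wt {p : ℝ} {u v : Rn n → ℝ}
    (hu : Integrable (fun x => u x * wt p x)) (hv : Integrable (fun x => v x * wt p x)) :
    Integrable (fun x => max (u x) (v x) * wt p x) := by
  refine (hu.sup hv).congr (Eventually.of_forall fun x => ?_)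
  simp [max_mul_of_nonneg _ _ (wt_pos p x).le]

theorem hasCompactSupport_indicator {q : Rn n → ℝ} (hc : HasCompactSupport q) (S : Set (Rn n)) :
    HasCompactSupport (S.indicator q) :=
  hc.mono (by rw [support_indicator]; exact inter_subset_right)

/-- The maximum of the two mollified functions, tested against `φ`, is controlled by the two
functions tested against the mollifications of `φ` cut off to the sets where each dominates. -/
theorem integral_max_mul_fracLaplacian_le (hn : 1 ≤ n) {s : ℝ} (hs0 : 0 < s) (hs1 : s < 1)
    {ρ : Rn n → ℝ} {ε : ℝ} (hρ : IsMollifier ρ ε) (hε : ε ≤ 1) {u v : Rn n → ℝ}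
    (hum : Measurable u) (hu : Integrable (fun x => u x * wt ((n : ℝ) + 2 * s) x))
    (hvm : Measurable v) (hv : Integrable (fun x => v x * wt ((n : ℝ) + 2 * s) x))
    {φ : Rn n → ℝ} (hφ : ContDiff ℝ 2 φ) (hc : HasCompactSupport φ) (hφ0 : ∀ x, 0 ≤ φ x) :
    ∫ x, max (cv ρ u x) (cv ρ v x) * fracLaplacian s φ x ≤
      (∫ x, u x * fracLaplacian s (cv ρ ({y | cv ρ v y < cv ρ u y}.indicator φ)) x) +
      ∫ x, v x * fracLaplacian s (cv ρ ({y | cv ρ u y ≤ cv ρ v y}.indicator φ)) x := by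
  have hp0 : 0 ≤ (n : ℝ) + 2 * s := by positivity
  have hp : (n : ℝ) < (n : ℝ) + 2 * s := by linarith
  obtain ⟨A, hA⟩ := hφ.continuous.bounded_above_of_compact_support hc
  have hUm : Measurable (cv ρ u) := measurable_cv hρ.measurable hum
  have hVm : Measurable (cv ρ v) := measurable_cv hρ.measurable hvm
  have hU := hρ.integrable_cv_mul_wt hε hp0 hum hu
  have hV := hρ.integrable_cv_mul_wt hε hp0 hvm hv
  have hW := integrable_max_mul_wt hU hV
  have hWm : Measurable (fun x => max (cv ρ u x) (cv ρ v x)) := hUm.max hVm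
  set q₁ := {y | cv ρ v y < cv ρ u y}.indicator φ with hq₁
  set q₂ := {y | cv ρ u y ≤ cv ρ v y}.indicator φ with hq₂
  have hm₁ : Measurable q₁ := hφ.continuous.measurable.indicator (measurableSet_lt hVm hUm)
  have hm₂ : Measurable q₂ := hφ.continuous.measurable.indicator (measurableSet_le hUm hVm)
  have hA₁ : ∀ x, |q₁ x| ≤ A := fun x => (norm_indicator_le_norm_self φ x).trans (hA x)
  have hA₂ : ∀ x, |q₂ x| ≤ A := fun x => (norm_indicator_le_norm_self φ x).trans (hA x)
  have hc₁ : HasCompactSupport q₁ := hasCompactSupport_indicator hc _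
  have hc₂ : HasCompactSupport q₂ := hasCompactSupport_indicator hc _
  have hsm : ∀ {q : Rn n → ℝ}, Measurable q → (∀ x, |q x| ≤ A) → HasCompactSupport q →
      ContDiff ℝ 2 (cv ρ q) := fun hm hA hc =>
    (hρ.contDiff_cv (integrable_of_bounded_of_hasCompactSupport hm hA hc).locallyIntegrable).of_le
      (WithTop.coe_le_coe.2 (le_top : (2 : ℕ∞) ≤ ⊤))
  -- All three test functions here, `φ` and the mollified cut-offs, are `C²` with compact support,
  -- so both sides are limits of their truncated versions; the comparison is made for each `η > 0`.
  refine le_of_tendsto_of_tendsto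
    (tendsto_integral_mul_fracTrunc hn hs0 hs1 hφ hc hWm hW)
    ((tendsto_integral_mul_fracTrunc hn hs0 hs1 (hsm hm₁ hA₁ hc₁)
      (hρ.hasCompactSupport_cv hc₁) hum hu).add
    (tendsto_integral_mul_fracTrunc hn hs0 hs1 (hsm hm₂ hA₂ hc₂)
      (hρ.hasCompactSupport_cv hc₂) hvm hv)) ?_
  filter_upwards [self_mem_nhdsWithin] with η hη
  rw [mem_Ioi] at hη
  rw [← mul_add]
  refine mul_le_mul_of_nonneg_left ?_ (fracConst_nonneg hs0 hs1)
  rw [integral_mul_fracTrunc_cv hs0 hη hρ hε hum hu hm₁ hA₁ hc₁,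
    integral_mul_fracTrunc_cv hs0 hη hρ hε hvm hv hm₂ hA₂ hc₂,
    integral_mul_fracTrunc_eq hs0 hη hWm hW hφ.continuous.measurable hA hc,
    integral_mul_fracTrunc_eq hs0 hη hUm hU hm₁ hA₁ hc₁,
    integral_mul_fracTrunc_eq hs0 hη hVm hV hm₂ hA₂ hc₂,
    ← integral_add (integrable_mul_trunc hs0 hη hUm hU hm₁ hA₁ hc₁)
      (integrable_mul_trunc hs0 hη hVm hV hm₂ hA₂ hc₂)]
  refine integral_mono
    (integrable_mul_trunc hs0 hη hWm hW hφ.continuous.measurable hA hc)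
    ((integrable_mul_trunc hs0 hη hUm hU hm₁ hA₁ hc₁).add
      (integrable_mul_trunc hs0 hη hVm hV hm₂ hA₂ hc₂)) fun x => ?_
  have hmono : ∀ {g : Rn n → ℝ}, Measurable g →
      Integrable (fun x => g x * wt ((n : ℝ) + 2 * s) x) →
      (∀ y, g y ≤ max (cv ρ u y) (cv ρ v y)) →
      cv (kern ((n : ℝ) + 2 * s) η) g x ≤
        cv (kern ((n : ℝ) + 2 * s) η) (fun y => max (cv ρ u y) (cv ρ v y)) x :=
    fun hgm hg hle => integral_mono (integrable_mul_kern_sub hp hη hgm hg x)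
      (integrable_mul_kern_sub hp hη hWm hW x)
      fun y => mul_le_mul_of_nonneg_right (hle y) (kern_nonneg _ _ _)
  have hUW := hmono hUm hU fun y => le_max_left _ _
  have hVW := hmono hVm hV fun y => le_max_right _ _
  have hφx := hφ0 x
  -- At each point the maximum equals the function selected by the cut-off, so the local parts
  -- agree, and the subtracted convolution is larger for the maximum.
  rcases lt_or_ge (cv ρ v x) (cv ρ u x) with hlt | hle
  · have e₁ : q₁ x = φ x := indicator_of_mem (by exact hlt) _
    have e₂ : q₂ x = 0 := indicator_of_notMem (by simpa using hlt) _
    simp only [e₁, e₂, zero_mul, add_zero, max_eq_left hlt.le]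
    gcongr
  · have e₁ : q₁ x = 0 := indicator_of_notMem (by simpa using hle) _
    have e₂ : q₂ x = φ x := indicator_of_mem (by exact hle) _
    simp only [e₁, e₂, zero_mul, zero_add, max_eq_right hle]
    gcongr

/-! ### Rescaled mollifiers, translations and local oscillation -/

/-- Rescaling of one fixed bump. The constant is independent of `ε`: the sizes `ε^(-n)` and
`ε^(-n-1)` are exactly what the averaged oscillation and the commutator estimate can absorb. -/
theorem exists_isMollifier (n : ℕ) : ∃ C : ℝ, 0 ≤ C ∧ ∀ ε : ℝ, 0 < ε → ∃ ρ : Rn n → ℝ,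
    IsMollifier ρ ε ∧ (∀ x, ρ x ≤ C * (ε ^ n)⁻¹) ∧
      ∀ x, ‖fderiv ℝ ρ x‖ ≤ C * (ε ^ n)⁻¹ * ε⁻¹ := by
  let f : ContDiffBump (0 : Rn n) := ⟨1 / 2, 1, by norm_num, by norm_num⟩
  set β : Rn n → ℝ := f.normed volume with hβ
  have hβd : ContDiff ℝ (⊤ : ℕ∞) β := f.contDiff_normed
  have hβc : HasCompactSupport β := f.hasCompactSupport_normed
  obtain ⟨A, hA⟩ := hβd.continuous.bounded_above_of_compact_support hβc
  obtain ⟨B, hB⟩ := (hβd.continuous_fderiv (by simp)).bounded_above_of_compact_support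
    (hβc.fderiv ℝ)
  have hA0 : 0 ≤ A := (norm_nonneg _).trans (hA 0)
  have hB0 : 0 ≤ B := (norm_nonneg _).trans (hB 0)
  refine ⟨A + B, by positivity, fun ε hε => ⟨fun x => (ε ^ n)⁻¹ * β (ε⁻¹ • x),
    ⟨?_, ?_, ?_, ?_, ?_⟩, ?_, ?_⟩⟩
  · exact contDiff_const.mul (hβd.comp (contDiff_const_smul _))
  · intro x
    have := f.nonneg_normed (μ := volume) (ε⁻¹ • x)
    positivity
  · intro x
    rw [smul_neg, hβ, f.normed_neg]
  · rw [integral_const_mul, Measure.integral_comp_inv_smul_of_nonneg volume β hε.le, hβ,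
      f.integral_normed, finrank_euclideanSpace_fin, smul_eq_mul, mul_one,
      inv_mul_cancel₀ (by positivity)]
  · intro x hx
    have : ε⁻¹ • x ∉ Function.support β := by
      rw [hβ, f.support_normed_eq, mem_ball_zero_iff, not_lt, norm_smul, norm_inv,
        Real.norm_of_nonneg hε.le]
      change 1 ≤ ε⁻¹ * ‖x‖
      rw [← div_eq_inv_mul, one_le_div hε]
      exact hx.le
    rw [Function.notMem_support.1 this, mul_zero]
  · intro x
    rw [mul_comm (A + B)]
    refine mul_le_mul_of_nonneg_left ?_ (by positivity)
    have := (le_abs_self _).trans (hA (ε⁻¹ • x))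
    linarith
  · intro x
    have h1 : HasFDerivAt (fun x => (ε ^ n)⁻¹ * β (ε⁻¹ • x))
        ((ε ^ n)⁻¹ • (fderiv ℝ β (ε⁻¹ • x)).comp (ε⁻¹ • ContinuousLinearMap.id ℝ (Rn n))) x :=
      (((hβd.differentiable (by simp)) (ε⁻¹ • x)).hasFDerivAt.comp x
        ((hasFDerivAt_id x).const_smul ε⁻¹)).const_mul _
    rw [h1.fderiv, ContinuousLinearMap.comp_smul, ContinuousLinearMap.comp_id, norm_smul, norm_smul,
      Real.norm_of_nonneg (by positivity), Real.norm_of_nonneg (by positivity)]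
    calc _ ≤ (ε ^ n)⁻¹ * (ε⁻¹ * (A + B)) := by
          gcongr
          exact (hB _).trans (by linarith)
      _ = _ := by ring

theorem tendsto_integral_translate_sub {U : Rn n → ℝ} (hU : Integrable U) :
    Tendsto (fun h => ∫ x, |U (x - h) - U x|) (𝓝 0) (𝓝 0) := by
  have hU1 : MemLp U 1 := memLp_one_iff_integrable.2 hU
  let g : C(Rn n, C(Rn n, Rn n)) :=
    (ContinuousMap.mk (fun a : Rn n × Rn n => a.2 - a.1) (by fun_prop)).curry
  have hg : ∀ h, MeasurePreserving (g h) volume volume := fun h =>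
    measurePreserving_sub_right volume h
  have hcont : Continuous fun h => Lp.compMeasurePreserving (g h) (hg h) (hU1.toLp U) :=
    (continuous_const (y := hU1.toLp U)).compMeasurePreservingLp g.continuous hg
      ENNReal.one_ne_top
  have h1 := ((hcont.sub (continuous_const (y := hU1.toLp U))).norm).tendsto 0
  have h2 : ∀ h, ‖Lp.compMeasurePreserving (g h) (hg h) (hU1.toLp U) - hU1.toLp U‖ =
      ∫ x, |U (x - h) - U x| := by
    intro h
    rw [L1.norm_eq_integral_norm, Lp.toLp_compMeasurePreserving hU1 (hg h)]
    refine integral_congr_ae ?_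
    filter_upwards [Lp.coeFn_sub ((hU1.comp_measurePreserving (hg h)).toLp _) (hU1.toLp U),
      (hU1.comp_measurePreserving (hg h)).coeFn_toLp, hU1.coeFn_toLp] with x h1 h2 h3
    rw [h1, Pi.sub_apply, h2, h3]
    rfl
  have h3 : ‖Lp.compMeasurePreserving (g 0) (hg 0) (hU1.toLp U) - hU1.toLp U‖ = 0 := by
    rw [h2]
    simp
  rw [← h3]
  exact h1.congr h2

/-- Translations are continuous in the weighted space. -/
theorem tendsto_integral_translate_sub_mul_wt {p : ℝ} (hp : 0 ≤ p) {u : Rn n → ℝ}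
    (hum : Measurable u) (hu : Integrable (fun x => u x * wt p x)) :
    Tendsto (fun h => ∫ x, |u (x - h) - u x| * wt p x) (𝓝 0) (𝓝 0) := by
  have hwm : Measurable (wt p : Rn n → ℝ) := (continuous_wt hp).measurable
  have h1 := tendsto_integral_translate_sub hu
  have hdom : ∀ h : Rn n, ‖h‖ ≤ 1 → ∀ y, |u y| * |wt p (y + h) - wt p y| ≤
      (2 + 2 ^ p) * ‖u y * wt p y‖ := by
    intro h hh y
    have e : wt p (y + h) ≤ (1 + 2 ^ p) * wt p y := by
      have := wt_sub_le hp zero_le_one (x := y) (h := -h) (by simpa using hh)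
      rwa [sub_neg_eq_add, one_add_one_eq_two] at this
    have e1 := wt_pos p (y + h)
    have e2 := wt_pos p y
    have e3 : |wt p (y + h) - wt p y| ≤ (2 + 2 ^ p) * wt p y := by
      rw [abs_le]
      have : 0 ≤ 2 ^ p * wt p y := by positivity
      constructor <;> nlinarith
    rw [norm_mul, Real.norm_of_nonneg e2.le, Real.norm_eq_abs]
    calc _ ≤ |u y| * ((2 + 2 ^ p) * wt p y) := by gcongr
      _ = _ := by ring
  have hball : ∀ᶠ h : Rn n in 𝓝 0, ‖h‖ ≤ 1 := by
    filter_upwards [Metric.closedBall_mem_nhds (0 : Rn n) zero_lt_one] with h hh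
    simpa using hh
  have hmeas : ∀ h : Rn n, AEStronglyMeasurable (fun y => |u y| * |wt p (y + h) - wt p y|) := by
    intro h
    have := hwm.comp (measurable_id.add_const h)
    exact (hum.abs.mul (this.sub hwm).abs).aestronglyMeasurable
  have h2 : Tendsto (fun h => ∫ y, |u y| * |wt p (y + h) - wt p y|) (𝓝 0) (𝓝 0) := by
    have := tendsto_integral_filter_of_dominated_convergence (μ := volume) (l := 𝓝 (0 : Rn n))
      (F := fun h y => |u y| * |wt p (y + h) - wt p y|) (f := fun _ => 0)
      (fun y => (2 + 2 ^ p) * ‖u y * wt p y‖) (Eventually.of_forall hmeas) ?_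
      (hu.norm.const_mul _) ?_
    · simpa using this
    · filter_upwards [hball] with h hh
      refine Eventually.of_forall fun y => ?_
      rw [Real.norm_of_nonneg (by positivity)]
      exact hdom h hh y
    · refine Eventually.of_forall fun y => ?_
      have hc : Continuous fun h : Rn n => |u y| * |wt p (y + h) - wt p y| := by
        have := (continuous_wt (n := n) hp).comp (continuous_const.add continuous_id : Continuous
          fun h : Rn n => y + h)
        exact continuous_const.mul (this.sub continuous_const).abs
      simpa using hc.tendsto 0
  have h3 := h1.add h2
  rw [add_zero] at h3
  refine squeeze_zero' (Eventually.of_forall fun h => integral_nonneg fun x =>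
    mul_nonneg (abs_nonneg _) (wt_pos p x).le) ?_ h3
  filter_upwards [hball] with h hh
  have hi2 : Integrable (fun y => |u y| * |wt p (y + h) - wt p y|) :=
    (hu.norm.const_mul (2 + 2 ^ p)).mono' (hmeas h) (Eventually.of_forall fun y => by
      rw [Real.norm_of_nonneg (by positivity)]
      exact hdom h hh y)
  have e : ∫ y, |u y| * |wt p (y + h) - wt p y| =
      ∫ x, |u (x - h)| * |wt p x - wt p (x - h)| := by
    rw [← integral_sub_right_eq_self _ h]
    simp
  have hi3 := hi2.comp_sub_right h
  simp only [sub_add_cancel] at hi3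
  have hi1 : Integrable (fun x => |u (x - h) * wt p (x - h) - u x * wt p x|) :=
    ((hu.comp_sub_right h).sub hu).abs
  rw [e, ← integral_add hi1 hi3]
  refine integral_mono_of_nonneg (Eventually.of_forall fun x =>
    mul_nonneg (abs_nonneg _) (wt_pos p x).le) (hi1.add hi3) (Eventually.of_forall fun x => ?_)
  -- Translate the product of `u` and the weight, which is in `L¹`, and correct by the increment of
  -- the weight. The first part tends to zero by continuity of translations in `L¹`, the second by
  -- dominated convergence.
  calc |u (x - h) - u x| * wt p x = |(u (x - h) * wt p (x - h) - u x * wt p x) +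
        u (x - h) * (wt p x - wt p (x - h))| := by
        rw [← abs_of_pos (wt_pos p x), ← abs_mul, abs_of_pos (wt_pos p x)]
        congr 1
        ring
    _ ≤ _ := by
        refine (abs_add_le _ _).trans ?_
        rw [abs_mul (u (x - h))]

/-- The local oscillation `∫_{|h| ≤ ε} |u(x - h) - u(x)| dh`. -/
def osc (ε : ℝ) (u : Rn n → ℝ) (x : Rn n) : ℝ :=
  ∫ h in Metric.closedBall (0 : Rn n) ε, |u (x - h) - u x|

theorem osc_nonneg (ε : ℝ) (u : Rn n → ℝ) (x : Rn n) : 0 ≤ osc ε u x :=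
  integral_nonneg fun _ => abs_nonneg _

theorem integrableOn_abs_sub {u : Rn n → ℝ} (hu : LocallyIntegrable u) (ε : ℝ) (x : Rn n) :
    IntegrableOn (fun h => |u (x - h) - u x|) (Metric.closedBall 0 ε) := by
  have h1 : IntegrableOn u (Metric.closedBall x ε) :=
    hu.integrableOn_isCompact (isCompact_closedBall _ _)
  have h2 := (h1.integrable_indicator measurableSet_closedBall).comp_sub_left x
  have h3 : IntegrableOn (fun h => u (x - h)) (Metric.closedBall 0 ε) := by
    refine h2.integrableOn.congr_fun (fun h hh => ?_) measurableSet_closedBall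
    refine indicator_of_mem ?_ u
    simpa [dist_eq_norm] using hh
  exact (h3.sub (integrableOn_const (isCompact_closedBall _ _).measure_lt_top.ne)).abs

theorem integrable_translate_sub_mul_wt {p : ℝ} (hp : 0 ≤ p) {u : Rn n → ℝ}
    (hum : Measurable u) (hu : Integrable (fun x => u x * wt p x)) (h : Rn n) :
    Integrable (fun x => |u (x - h) - u x| * wt p x) := by
  have h1 : Integrable (fun x => u (x - h) * wt p x) := by
    refine ((hu.comp_sub_right h).norm.const_mul (1 + (1 + ‖h‖) ^ p)).mono'
      ((hum.comp (measurable_id.sub_const h)).mul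
        (continuous_wt hp).measurable).aestronglyMeasurable (Eventually.of_forall fun x => ?_)
    have := wt_sub_le hp (norm_nonneg h) (x := x - h) (h := -h) (by simp)
    rw [sub_neg_eq_add, sub_add_cancel] at this
    rw [norm_mul, norm_mul, Real.norm_of_nonneg (wt_pos p _).le,
      Real.norm_of_nonneg (wt_pos p _).le]
    calc _ ≤ ‖u (x - h)‖ * ((1 + (1 + ‖h‖) ^ p) * wt p (x - h)) := by gcongr
      _ = _ := by ring
  refine (h1.sub hu).abs.congr (Eventually.of_forall fun x => ?_)
  simp only [Pi.sub_apply]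
  rw [← sub_mul, abs_mul, abs_of_pos (wt_pos p x)]

/-- Fubini: integrating in `x` first leaves the weighted translation modulus, at most `δ` for each
`h` in the ball. -/
theorem integrable_osc_mul_wt {p : ℝ} (hp : 0 ≤ p) {u : Rn n → ℝ} (hum : Measurable u)
    (hu : Integrable (fun x => u x * wt p x)) {ε δ : ℝ}
    (hδ : ∀ h : Rn n, ‖h‖ ≤ ε → ∫ x, |u (x - h) - u x| * wt p x ≤ δ) :
    Integrable (fun x => osc ε u x * wt p x) ∧
      ∫ x, osc ε u x * wt p x ≤ volume.real (Metric.closedBall (0 : Rn n) ε) * δ := by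
  have hm : Measurable (fun z : Rn n × Rn n => |u (z.1 - z.2) - u z.1| * wt p z.1) :=
    ((hum.comp (measurable_fst.sub measurable_snd)).sub (hum.comp measurable_fst)).abs.mul
      ((continuous_wt hp).measurable.comp measurable_fst)
  have hnn : ∀ x h : Rn n, 0 ≤ |u (x - h) - u x| * wt p x := fun x h =>
    mul_nonneg (abs_nonneg _) (wt_pos p x).le
  have hball : volume (Metric.closedBall (0 : Rn n) ε) ≠ ∞ :=
    (isCompact_closedBall _ _).measure_lt_top.ne
  have hmi : StronglyMeasurable (fun h : Rn n => ∫ x, |u (x - h) - u x| * wt p x) :=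
    hm.stronglyMeasurable.integral_prod_left
  have hi2 : IntegrableOn (fun h : Rn n => ∫ x, |u (x - h) - u x| * wt p x)
      (Metric.closedBall (0 : Rn n) ε) := by
    refine Measure.integrableOn_of_bounded (M := δ) hball hmi.aestronglyMeasurable ?_
    refine (ae_restrict_iff' measurableSet_closedBall).2 (Eventually.of_forall fun h hh => ?_)
    rw [Real.norm_of_nonneg (integral_nonneg fun x => hnn x h)]
    exact hδ h (by simpa using hh)
  have hi : Integrable (fun z : Rn n × Rn n => |u (z.1 - z.2) - u z.1| * wt p z.1)
      (volume.prod (volume.restrict (Metric.closedBall (0 : Rn n) ε))) := by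
    rw [integrable_prod_iff' hm.aestronglyMeasurable]
    refine ⟨Eventually.of_forall fun h => integrable_translate_sub_mul_wt hp hum hu h, ?_⟩
    refine hi2.congr (Eventually.of_forall fun h => ?_)
    refine integral_congr_ae (Eventually.of_forall fun x => ?_)
    exact (Real.norm_of_nonneg (hnn x h)).symm
  have he : ∀ x, (∫ h in Metric.closedBall (0 : Rn n) ε, |u (x - h) - u x| * wt p x) =
      osc ε u x * wt p x := fun x => integral_mul_const _ _
  refine ⟨?_, ?_⟩
  · have := hi.integral_prod_left
    simp only [he] at this
    exact this
  · have hsw := integral_integral_swap (f := fun x h : Rn n => |u (x - h) - u x| * wt p x) hi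
    simp only [he] at hsw
    rw [hsw]
    calc _ ≤ ∫ h in Metric.closedBall (0 : Rn n) ε, δ :=
          setIntegral_mono_on hi2 (integrableOn_const hball) measurableSet_closedBall
            fun h hh => hδ h (by simpa using hh)
      _ = _ := by simp

theorem eventually_integrable_osc {p : ℝ} (hp : 0 ≤ p) {u : Rn n → ℝ} (hum : Measurable u)
    (hu : Integrable (fun x => u x * wt p x)) {δ : ℝ} (hδ : 0 < δ) :
    ∀ᶠ ε in 𝓝[>] (0 : ℝ), Integrable (fun x => osc ε u x * wt p x) ∧
      (ε ^ n)⁻¹ * ∫ x, osc ε u x * wt p x ≤ δ := by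
  set V : ℝ := volume.real (Metric.closedBall (0 : Rn n) 1)
  have hV : 0 ≤ V := measureReal_nonneg
  -- The ball of radius `ε` has volume `ε^n V`. Dividing by `1 + V` rather than by `V` avoids
  -- needing `V > 0`.
  have h1 := (tendsto_integral_translate_sub_mul_wt hp hum hu).eventually_le_const
    (show (0 : ℝ) < δ / (1 + V) by positivity)
  obtain ⟨r, hr, hball⟩ := Metric.eventually_nhds_iff.1 h1
  have h2 : ∀ᶠ ε in 𝓝[>] (0 : ℝ), ε < r :=
    (eventually_lt_nhds hr).filter_mono nhdsWithin_le_nhds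
  filter_upwards [h2, self_mem_nhdsWithin] with ε hεr hε
  have hε : 0 < ε := hε
  obtain ⟨a, b⟩ := integrable_osc_mul_wt hp hum hu (ε := ε) (δ := δ / (1 + V))
    fun h hh => hball (by simpa using hh.trans_lt hεr)
  refine ⟨a, ?_⟩
  have hvol : volume.real (Metric.closedBall (0 : Rn n) ε) = ε ^ n * V := by
    have := Measure.addHaar_real_closedBall' (volume : Measure (Rn n)) 0 hε.le
    rwa [finrank_euclideanSpace_fin] at this
  rw [hvol] at b
  calc _ ≤ (ε ^ n)⁻¹ * (ε ^ n * V * (δ / (1 + V))) := by gcongr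
    _ = V / (1 + V) * δ := by field_simp
    _ ≤ 1 * δ := by
        gcongr
        rw [div_le_one (by positivity)]
        linarith
    _ = δ := one_mul δ

theorem tendsto_integral_osc {p : ℝ} (hp : 0 ≤ p) {u : Rn n → ℝ} (hum : Measurable u)
    (hu : Integrable (fun x => u x * wt p x)) :
    Tendsto (fun ε : ℝ => (ε ^ n)⁻¹ * ∫ x, osc ε u x * wt p x) (𝓝[>] 0) (𝓝 0) := by
  rw [tendsto_order]
  constructor
  · intro a ha
    filter_upwards [self_mem_nhdsWithin] with ε hε
    have hε : 0 < ε := hε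
    have : 0 ≤ ∫ x, osc ε u x * wt p x :=
      integral_nonneg fun x => mul_nonneg (osc_nonneg _ _ _) (wt_pos p x).le
    refine ha.trans_le (by positivity)
  · intro a ha
    filter_upwards [eventually_integrable_osc hp hum hu (half_pos ha)] with ε hε
    linarith [hε.2]

/-- Since `ρ` has mass one, the difference is `∫ (u (x - h) - u x) ρ h dh`, with `ρ ≤ D` supported
in the ball. -/
theorem IsMollifier.abs_cv_sub_le {ρ : Rn n → ℝ} {ε : ℝ} (hρ : IsMollifier ρ ε) {D : ℝ}
    (hD : ∀ x, ρ x ≤ D) {u : Rn n → ℝ} (hu : LocallyIntegrable u) (x : Rn n) :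
    |cv ρ u x - u x| ≤ D * osc ε u x := by
  have e1 : cv ρ u x = ∫ h, u (x - h) * ρ h := by
    rw [cv, ← integral_sub_left_eq_self _ volume x]
    simp
  have e2 : u x = ∫ h, u x * ρ h := by rw [integral_const_mul, hρ.integral_eq_one, mul_one]
  have hi : Integrable (fun h => u (x - h) * ρ h) := by
    have : Integrable (fun y => u y * ρ (x - y)) :=
      (HasCompactSupport.convolutionExists_right (ContinuousLinearMap.mul ℝ ℝ)
        hρ.hasCompactSupport hu hρ.continuous x)
    simpa using this.comp_sub_left x
  rw [e1]
  nth_rewrite 1 [e2]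
  rw [← integral_sub hi (hρ.integrable.const_mul _), osc, ← integral_const_mul,
    ← integral_indicator measurableSet_closedBall, ← Real.norm_eq_abs]
  refine norm_integral_le_of_norm_le
    (IntegrableOn.integrable_indicator ((integrableOn_abs_sub hu ε x).const_mul D)
      measurableSet_closedBall)
    (Eventually.of_forall fun h => ?_)
  rw [← sub_mul, norm_mul, Real.norm_of_nonneg (hρ.nonneg h), Real.norm_eq_abs]
  by_cases hh : h ∈ Metric.closedBall (0 : Rn n) ε
  · rw [indicator_of_mem hh, mul_comm]
    gcongr
    exact hD h
  · rw [indicator_of_notMem hh, hρ.eq_zero h (by simpa using hh), mul_zero]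

/-! ### Cut-offs, divergence and integration by parts -/

theorem exists_cutoff {K O : Set (Rn n)} (hK : IsCompact K) (hO : IsOpen O) (hKO : K ⊆ O) :
    ∃ χ : Rn n → ℝ, ContDiff ℝ (⊤ : ℕ∞) χ ∧ HasCompactSupport χ ∧ tsupport χ ⊆ O ∧
      (∀ᶠ x in 𝓝ˢ K, χ x = 1) := by
  obtain ⟨L, hL, hKL, hLO⟩ := exists_compact_between hK hO hKO
  obtain ⟨f, hf1, hf0, -⟩ := exists_contMDiffMap_one_nhds_of_subset_interior
    (modelWithCornersSelf ℝ (Rn n)) (n := ⊤) hK.isClosed hKL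
  have hsub : tsupport f ⊆ L := closure_minimal
    (fun x hx => by_contra fun hxL => hx (hf0 x hxL)) hL.isClosed
  exact ⟨f, f.contMDiff.contDiff, hL.of_isClosed_subset (isClosed_tsupport _) hsub,
    hsub.trans hLO, hf1⟩

theorem sum_map_single_mul (L : Rn n →L[ℝ] ℝ) (v : Rn n) :
    ∑ i, L (EuclideanSpace.single i 1) * v i = L v := by
  have h := (EuclideanSpace.basisFun (Fin n) ℝ).sum_repr v
  conv_rhs => rw [← h]
  rw [map_sum]
  refine Finset.sum_congr rfl fun i _ => ?_
  simp [mul_comm]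

theorem divergence_smul {ψ : Rn n → ℝ} {B : Rn n → Rn n} {x : Rn n}
    (hψ : DifferentiableAt ℝ ψ x) (hB : DifferentiableAt ℝ B x) :
    divergence (fun y => ψ y • B y) x = ψ x * divergence B x + fderiv ℝ ψ x (B x) := by
  have h : HasFDerivAt (fun y => ψ y • B y)
      (ψ x • fderiv ℝ B x + (fderiv ℝ ψ x).smulRight (B x)) x :=
    hψ.hasFDerivAt.smul hB.hasFDerivAt
  unfold divergence
  rw [h.fderiv, ← sum_map_single_mul (fderiv ℝ ψ x) (B x),
    Finset.mul_sum, ← Finset.sum_add_distrib]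
  refine Finset.sum_congr rfl fun i _ => ?_
  simp

theorem fderiv_coord {F : Rn n → Rn n} {x : Rn n} (hF : DifferentiableAt ℝ F x) (i : Fin n)
    (v : Rn n) : fderiv ℝ (fun y => F y i) x v = fderiv ℝ F x v i := by
  have h := ((EuclideanSpace.proj i : Rn n →L[ℝ] ℝ).hasFDerivAt (x := F x)).comp x hF.hasFDerivAt
  have h2 : fderiv ℝ (fun y => F y i) x = (EuclideanSpace.proj i : Rn n →L[ℝ] ℝ).comp
      (fderiv ℝ F x) := h.fderiv
  rw [h2]
  rfl

section Divergence

variable {F : Rn n → Rn n}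

theorem continuous_divergence (hF : ContDiff ℝ 1 F) : Continuous (divergence F) := by
  unfold divergence
  refine continuous_finsetSum _ fun i _ => ?_
  have h := (hF.continuous_fderiv one_ne_zero).clm_apply
    (continuous_const (y := (EuclideanSpace.single i 1 : Rn n)))
  exact (EuclideanSpace.proj i : Rn n →L[ℝ] ℝ).continuous.comp h

theorem divergence_eq_zero_of_notMem {x : Rn n} (hx : x ∉ tsupport F) : divergence F x = 0 := by
  have : fderiv ℝ F x = 0 := by
    by_contra h
    exact hx (support_fderiv_subset ℝ h)
  simp [divergence, this]

theorem hasCompactSupport_divergence (hc : HasCompactSupport F) :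
    HasCompactSupport (divergence F) :=
  hc.of_isClosed_subset (isClosed_tsupport _) (closure_minimal (fun _ hx =>
    by_contra fun h => hx (divergence_eq_zero_of_notMem h)) (isClosed_tsupport _))

theorem hasCompactSupport_coord (hc : HasCompactSupport F) (i : Fin n) :
    HasCompactSupport (fun y => F y i) :=
  hc.comp_left (g := fun v : Rn n => v i) rfl

theorem contDiff_coord (hF : ContDiff ℝ 1 F) (i : Fin n) : ContDiff ℝ 1 (fun y => F y i) :=
  (EuclideanSpace.proj i : Rn n →L[ℝ] ℝ).contDiff.comp hF

theorem integral_mul_divergence (hF : ContDiff ℝ 1 F) (hc : HasCompactSupport F) {z : Rn n → ℝ}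
    (hz : ContDiff ℝ 1 z) : ∫ x, z x * divergence F x = - ∫ x, fderiv ℝ z x (F x) := by
  have hFd : Differentiable ℝ F := hF.differentiable one_ne_zero
  have hzd : Differentiable ℝ z := hz.differentiable one_ne_zero
  have hi1 : ∀ i : Fin n, Integrable
      (fun x => z x * fderiv ℝ (fun y => F y i) x (EuclideanSpace.single i 1)) := fun i => by
    refine (hz.continuous.mul (((contDiff_coord hF i).continuous_fderiv one_ne_zero).clm_apply
      continuous_const)).integrable_of_hasCompactSupport ?_
    exact (((hasCompactSupport_coord hc i).fderiv ℝ).comp_left (g := fun L : Rn n →L[ℝ] ℝ =>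
      L (EuclideanSpace.single i 1)) rfl).mul_left
  have hi2 : ∀ i : Fin n, Integrable
      (fun x => fderiv ℝ z x (EuclideanSpace.single i 1) * F x i) := fun i =>
    (((hz.continuous_fderiv one_ne_zero).clm_apply continuous_const).mul
      (contDiff_coord hF i).continuous).integrable_of_hasCompactSupport
      (hasCompactSupport_coord hc i).mul_left
  have hi3 : ∀ i : Fin n, Integrable (fun x => z x * F x i) := fun i =>
    (hz.continuous.mul (contDiff_coord hF i).continuous).integrable_of_hasCompactSupport
      (hasCompactSupport_coord hc i).mul_left
  calc ∫ x, z x * divergence F x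
      = ∫ x, ∑ i, z x * fderiv ℝ (fun y => F y i) x (EuclideanSpace.single i 1) := by
        congr 1
        ext x
        rw [divergence, Finset.mul_sum]
        exact Finset.sum_congr rfl fun i _ => by rw [fderiv_coord (hFd x)]
    _ = ∑ i, ∫ x, z x * fderiv ℝ (fun y => F y i) x (EuclideanSpace.single i 1) :=
        integral_finsetSum _ fun i _ => hi1 i
    _ = ∑ i, - ∫ x, fderiv ℝ z x (EuclideanSpace.single i 1) * F x i :=
        Finset.sum_congr rfl fun i _ =>
          integral_mul_fderiv_eq_neg_fderiv_mul_of_integrable (hi2 i) (hi1 i) (hi3 i)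
            (fun x _ => hzd x)
            (fun x _ => ((contDiff_coord hF i).differentiable one_ne_zero) x)
    _ = - ∫ x, ∑ i, fderiv ℝ z x (EuclideanSpace.single i 1) * F x i := by
        rw [Finset.sum_neg_distrib, integral_finsetSum _ fun i _ => hi2 i]
    _ = _ := by simp_rw [sum_map_single_mul]

theorem integral_divergence_eq_zero (hF : ContDiff ℝ 1 F) (hc : HasCompactSupport F) :
    ∫ x, divergence F x = 0 := by
  simpa using integral_mul_divergence hF hc (z := fun _ => 1) contDiff_const

/-- Stated with line derivatives so that it holds at every point, including zeros of `z` where the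
positive part has a corner. -/
theorem lineDeriv_max_zero {z : Rn n → ℝ} (hz : ContDiff ℝ 1 z) (x v : Rn n) :
    lineDeriv ℝ (fun y => max (z y) 0) x v = {y | 0 < z y}.indicator (fun y => fderiv ℝ z y v) x := by
  have hzd : Differentiable ℝ z := hz.differentiable one_ne_zero
  rcases lt_trichotomy (z x) 0 with h | h | h
  · rw [indicator_of_notMem (by simpa using h.le)]
    have : (fun y => max (z y) 0) =ᶠ[𝓝 x] fun _ => (0 : ℝ) := by
      filter_upwards [hz.continuous.continuousAt.eventually_lt_const h] with y hy
      exact max_eq_right hy.le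
    rw [this.lineDeriv_eq]
    simp [lineDeriv]
  · rw [indicator_of_notMem (by simp [h])]
    -- At a zero of `z` the positive part has a minimum along the line, so its line derivative
    -- vanishes: if it exists by Fermat's rule, and otherwise by the default value `0` of `deriv`.
    refine IsLocalMin.deriv_eq_zero (Eventually.of_forall fun t => ?_)
    change max (z (x + (0 : ℝ) • v)) 0 ≤ max (z (x + t • v)) 0
    rw [zero_smul, add_zero, h, max_self]
    exact le_max_right _ _
  · rw [indicator_of_mem (by exact h)]
    have : (fun y => max (z y) 0) =ᶠ[𝓝 x] z := by
      filter_upwards [hz.continuous.continuousAt.eventually_const_lt h] with y hy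
      exact max_eq_left hy.le
    rw [this.lineDeriv_eq, (hzd x).lineDeriv_eq_fderiv]

/-- Integration by parts for the positive part of a `C¹` function. -/
theorem integral_max_zero_mul_divergence (hF : ContDiff ℝ 1 F) (hc : HasCompactSupport F)
    {z : Rn n → ℝ} (hz : ContDiff ℝ 1 z) :
    ∫ x, max (z x) 0 * divergence F x =
      - ∫ x, {y | 0 < z y}.indicator (fun y => fderiv ℝ z y (F y)) x := by
  have hFd : Differentiable ℝ F := hF.differentiable one_ne_zero
  -- Multiplying `z` by a cut-off makes it globally Lipschitz, as integration by parts for Lipschitz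
  -- functions requires. The cut-off is `1` near the support of `F`, so neither `z` nor its
  -- derivative changes there.
  obtain ⟨χ, hχ, hχc, -, hχ1⟩ := exists_cutoff hc.isCompact isOpen_univ (subset_univ _)
  rw [eventually_nhdsSet_iff_forall] at hχ1
  set Z : Rn n → ℝ := fun x => χ x * z x with hZdef
  have hZ : ContDiff ℝ 1 Z := (hχ.of_le (WithTop.coe_le_coe.2 (le_top : (1 : ℕ∞) ≤ ⊤))).mul hz
  have hZc : HasCompactSupport Z := hχc.mul_right
  have hZz : ∀ x ∈ tsupport F, Z =ᶠ[𝓝 x] z := fun x hx => by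
    filter_upwards [hχ1 x hx] with y hy
    simp [hZdef, hy]
  obtain ⟨C, hC⟩ := hZ.lipschitzWith_of_hasCompactSupport hZc one_ne_zero
  have hP : LipschitzWith C (fun x => max (Z x) 0) := hC.max_const 0
  have hPc : Continuous fun x => max (Z x) 0 := hP.continuous
  have hi1 : ∀ i : Fin n, Integrable
      (fun x => max (Z x) 0 * fderiv ℝ (fun y => F y i) x (EuclideanSpace.single i 1)) :=
    fun i => by
    refine (hPc.mul (((contDiff_coord hF i).continuous_fderiv one_ne_zero).clm_apply
      continuous_const)).integrable_of_hasCompactSupport ?_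
    exact (((hasCompactSupport_coord hc i).fderiv ℝ).comp_left (g := fun L : Rn n →L[ℝ] ℝ =>
      L (EuclideanSpace.single i 1)) rfl).mul_left
  have hi2 : ∀ i : Fin n, Integrable
      (fun x => {y | 0 < Z y}.indicator
        (fun y => fderiv ℝ Z y (EuclideanSpace.single i 1)) x * F x i) := fun i => by
    have h0 : Integrable (fun x => fderiv ℝ Z x (EuclideanSpace.single i 1) * F x i) :=
      (((hZ.continuous_fderiv one_ne_zero).clm_apply continuous_const).mul
        (contDiff_coord hF i).continuous).integrable_of_hasCompactSupport
        (hasCompactSupport_coord hc i).mul_left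
    refine (h0.indicator (measurableSet_lt (measurable_const (a := (0 : ℝ))) hZ.continuous.measurable)).congr
      (Eventually.of_forall fun x => ?_)
    by_cases hx : 0 < Z x
    · simp [indicator, hx]
    · simp [indicator, hx]
  have hstep : ∀ i : Fin n, ∫ x, max (Z x) 0 *
      fderiv ℝ (fun y => F y i) x (EuclideanSpace.single i 1) =
      - ∫ x, {y | 0 < Z y}.indicator
        (fun y => fderiv ℝ Z y (EuclideanSpace.single i 1)) x * F x i := by
    intro i
    obtain ⟨D, hD⟩ := (contDiff_coord hF i).lipschitzWith_of_hasCompactSupport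
      (hasCompactSupport_coord hc i) one_ne_zero
    have h := hP.integral_lineDeriv_mul_eq (μ := volume) hD (hasCompactSupport_coord hc i)
      (EuclideanSpace.single i 1)
    simp_rw [lineDeriv_max_zero hZ] at h
    rw [h, ← integral_neg]
    congr 1
    ext x
    rw [(((contDiff_coord hF i).differentiable one_ne_zero) x).lineDeriv_eq_fderiv, map_neg]
    ring
  calc ∫ x, max (z x) 0 * divergence F x
      = ∫ x, ∑ i, max (Z x) 0 * fderiv ℝ (fun y => F y i) x (EuclideanSpace.single i 1) := by
        congr 1
        ext x
        by_cases hx : x ∈ tsupport F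
        · rw [divergence, Finset.mul_sum, (hZz x hx).eq_of_nhds]
          exact Finset.sum_congr rfl fun i _ => by rw [fderiv_coord (hFd x)]
        · have h0 := divergence_eq_zero_of_notMem hx
          rw [← Finset.mul_sum, h0, mul_zero]
          have : ∑ i, fderiv ℝ (fun y => F y i) x (EuclideanSpace.single i 1) = 0 := by
            rw [← h0]
            exact Finset.sum_congr rfl fun i _ => fderiv_coord (hFd x) i _
          rw [this, mul_zero]
    _ = ∑ i, ∫ x, max (Z x) 0 * fderiv ℝ (fun y => F y i) x (EuclideanSpace.single i 1) :=
        integral_finsetSum _ fun i _ => hi1 i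
    _ = ∑ i, - ∫ x, {y | 0 < Z y}.indicator
          (fun y => fderiv ℝ Z y (EuclideanSpace.single i 1)) x * F x i :=
        Finset.sum_congr rfl fun i _ => hstep i
    _ = - ∫ x, ∑ i, {y | 0 < Z y}.indicator
          (fun y => fderiv ℝ Z y (EuclideanSpace.single i 1)) x * F x i := by
        rw [Finset.sum_neg_distrib, integral_finsetSum _ fun i _ => hi2 i]
    _ = _ := by
        congr 2
        ext x
        by_cases hx : x ∈ tsupport F
        · have e1 := (hZz x hx).eq_of_nhds
          have e2 := (hZz x hx).fderiv_eq (𝕜 := ℝ)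
          by_cases h0 : 0 < z x
          · simp only [indicator, mem_ofPred_eq, e1, h0, if_true, e2, sum_map_single_mul]
          · simp [indicator, e1, h0]
        · simp [image_eq_zero_of_notMem_tsupport hx, indicator]

end Divergence

/-! ### Mollification and the drift: the commutator estimate -/

namespace IsMollifier

variable {ρ : Rn n → ℝ} {ε : ℝ}

theorem contDiff_one (h : IsMollifier ρ ε) : ContDiff ℝ 1 ρ :=
  h.contDiff.of_le (WithTop.coe_le_coe.2 (le_top : (1 : ℕ∞) ≤ ⊤))

theorem differentiable (h : IsMollifier ρ ε) : Differentiable ℝ ρ :=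
  h.contDiff_one.differentiable one_ne_zero

theorem continuous_fderiv (h : IsMollifier ρ ε) : Continuous (fderiv ℝ ρ) :=
  h.contDiff_one.continuous_fderiv one_ne_zero

theorem fderiv_neg (h : IsMollifier ρ ε) (x : Rn n) : fderiv ℝ ρ (-x) = - fderiv ℝ ρ x := by
  have e : (fun y => ρ (-y)) = ρ := funext h.even
  have h1 : HasFDerivAt (fun y => ρ (-y)) (-fderiv ℝ ρ (-x)) x := by
    have := (h.differentiable (-x)).hasFDerivAt.comp x (hasFDerivAt_id x).neg
    rwa [ContinuousLinearMap.comp_neg, ContinuousLinearMap.comp_id] at this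
  rw [e] at h1
  rw [h1.fderiv, neg_neg]

theorem fderiv_eq_zero (h : IsMollifier ρ ε) {x : Rn n} (hx : ε < ‖x‖) : fderiv ℝ ρ x = 0 := by
  by_contra h0
  have := h.tsupport_subset (support_fderiv_subset ℝ h0)
  rw [mem_closedBall_zero_iff] at this
  exact absurd hx (not_lt.2 this)

theorem integrable_mul_fderiv (h : IsMollifier ρ ε) {u : Rn n → ℝ} (hu : LocallyIntegrable u)
    (x v : Rn n) : Integrable (fun y => u y * fderiv ℝ ρ (x - y) v) := by
  have hc : HasCompactSupport (fun y => fderiv ℝ ρ y v) :=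
    (h.hasCompactSupport.fderiv ℝ).comp_left (g := fun L : Rn n →L[ℝ] ℝ => L v) rfl
  exact hc.convolutionExists_right (ContinuousLinearMap.mul ℝ ℝ) hu
    (h.continuous_fderiv.clm_apply continuous_const) x

theorem fderiv_cv (h : IsMollifier ρ ε) {u : Rn n → ℝ} (hu : LocallyIntegrable u) (x v : Rn n) :
    fderiv ℝ (cv ρ u) x v = ∫ y, u y * fderiv ℝ ρ (x - y) v := by
  have h1 := h.hasCompactSupport.hasFDerivAt_convolution_right (ContinuousLinearMap.mul ℝ ℝ)
    hu h.contDiff_one x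
  have h2 : fderiv ℝ (cv ρ u) x = _ := h1.fderiv
  have h3 : Integrable (fun t => (ContinuousLinearMap.precompR (Rn n)
      (ContinuousLinearMap.mul ℝ ℝ)) (u t) (fderiv ℝ ρ (x - t))) :=
    (h.hasCompactSupport.fderiv ℝ).convolutionExists_right _ hu h.continuous_fderiv x
  rw [h2, convolution_def, ContinuousLinearMap.integral_apply h3]
  rfl

theorem integrable_mul (h : IsMollifier ρ ε) {u : Rn n → ℝ} (hu : LocallyIntegrable u)
    (x : Rn n) : Integrable (fun y => u y * ρ (x - y)) :=
  h.hasCompactSupport.convolutionExists_right (ContinuousLinearMap.mul ℝ ℝ) hu h.continuous x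

end IsMollifier

section Drift

variable {ρ : Rn n → ℝ} {ε : ℝ} {B : Rn n → Rn n} {u q : Rn n → ℝ}

/-- The kernel `div_y (ρ(y - x) B(y))`. -/
def driftKernel (ρ : Rn n → ℝ) (B : Rn n → Rn n) (x y : Rn n) : ℝ :=
  ρ (y - x) * divergence B y + fderiv ℝ ρ (y - x) (B y)

theorem continuous_driftKernel (hρ : IsMollifier ρ ε) (hB : ContDiff ℝ 1 B) :
    Continuous (fun z : Rn n × Rn n => driftKernel ρ B z.1 z.2) := by
  unfold driftKernel
  have h1 : Continuous fun z : Rn n × Rn n => z.2 - z.1 := continuous_snd.sub continuous_fst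
  exact ((hρ.continuous.comp h1).mul ((continuous_divergence hB).comp continuous_snd)).add
    ((hρ.continuous_fderiv.comp h1).clm_apply (hB.continuous.comp continuous_snd))

theorem divergence_cv_smul (hρ : IsMollifier ρ ε) (hB : ContDiff ℝ 1 B)
    (hq : LocallyIntegrable q) (y : Rn n) :
    divergence (fun y => cv ρ q y • B y) y = ∫ x, q x * driftKernel ρ B x y := by
  have hd : DifferentiableAt ℝ (cv ρ q) y :=
    ((hρ.contDiff_cv hq).differentiable (by simp)) y
  rw [divergence_smul hd ((hB.differentiable one_ne_zero) y), hρ.fderiv_cv hq, cv,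
    ← integral_mul_const, ← integral_add ((hρ.integrable_mul hq y).mul_const _)
      (hρ.integrable_mul_fderiv hq y _)]
  congr 1
  ext x
  rw [driftKernel]
  ring

/-- The kernel is bounded and vanishes for `y` outside the support of `B`, so only the integral of
`u` over a compact set enters. -/
theorem integrable_prod_driftKernel (hρ : IsMollifier ρ ε) (hB : ContDiff ℝ 1 B)
    (hBc : HasCompactSupport B) (hum : Measurable u) (hu : LocallyIntegrable u)
    (hqm : Measurable q) (hq : Integrable q) :
    Integrable (fun z : Rn n × Rn n => u z.2 * (q z.1 * driftKernel ρ B z.1 z.2))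
      (volume.prod volume) := by
  obtain ⟨R, hR⟩ := hρ.exists_le
  obtain ⟨R', hR'⟩ := hρ.continuous_fderiv.bounded_above_of_compact_support
    (hρ.hasCompactSupport.fderiv ℝ)
  obtain ⟨D, hD⟩ := (continuous_divergence hB).bounded_above_of_compact_support
    (hasCompactSupport_divergence hBc)
  obtain ⟨M, hM⟩ := hB.continuous.bounded_above_of_compact_support hBc
  have hR0 : 0 ≤ R := (abs_nonneg _).trans (hR 0)
  have hR0' : 0 ≤ R' := (norm_nonneg _).trans (hR' 0)
  have hKle : ∀ x y, ‖driftKernel ρ B x y‖ ≤ R * D + R' * M := by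
    intro x y
    refine (norm_add_le _ _).trans (add_le_add ?_ ?_)
    · rw [norm_mul]
      exact mul_le_mul (hR _) (hD y) (norm_nonneg _) hR0
    · exact (ContinuousLinearMap.le_opNorm _ _).trans
        (mul_le_mul (hR' _) (hM y) (norm_nonneg _) hR0')
  have hK0 : ∀ x y, y ∉ tsupport B → driftKernel ρ B x y = 0 := by
    intro x y hy
    rw [driftKernel, divergence_eq_zero_of_notMem hy, image_eq_zero_of_notMem_tsupport hy, map_zero,
      mul_zero, add_zero]
  have hui : Integrable ((tsupport B).indicator u) :=
    (hu.integrableOn_isCompact hBc.isCompact).integrable_indicator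
      (isClosed_tsupport B).measurableSet
  refine ((hq.mul_prod hui).norm.const_mul (R * D + R' * M)).mono' ?_
    (Eventually.of_forall fun z => ?_)
  · exact ((hum.comp measurable_snd).mul ((hqm.comp measurable_fst).mul
      (continuous_driftKernel hρ hB).measurable)).aestronglyMeasurable
  · by_cases hz : z.2 ∈ tsupport B
    · rw [indicator_of_mem hz]
      simp only [norm_mul]
      calc _ ≤ ‖u z.2‖ * (‖q z.1‖ * (R * D + R' * M)) := by
            gcongr
            exact hKle _ _
        _ = _ := by ring
    · rw [hK0 _ _ hz, indicator_of_notMem hz]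
      simp

theorem integral_mul_divergence_cv_smul (hρ : IsMollifier ρ ε) (hB : ContDiff ℝ 1 B)
    (hBc : HasCompactSupport B) (hum : Measurable u) (hu : LocallyIntegrable u)
    (hqm : Measurable q) (hq : Integrable q) :
    ∫ y, u y * divergence (fun y => cv ρ q y • B y) y =
      ∫ x, q x * ∫ y, u y * driftKernel ρ B x y := by
  simp only [divergence_cv_smul hρ hB hq.locallyIntegrable, ← integral_const_mul]
  have h := integral_integral_swap
    (f := fun x y => u y * (q x * driftKernel ρ B x y))
    (integrable_prod_driftKernel hρ hB hBc hum hu hqm hq)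
  rw [← h]
  congr 1
  ext x
  congr 1
  ext y
  ring

theorem integrable_mul_integral_driftKernel (hρ : IsMollifier ρ ε) (hB : ContDiff ℝ 1 B)
    (hBc : HasCompactSupport B) (hum : Measurable u) (hu : LocallyIntegrable u)
    (hqm : Measurable q) (hq : Integrable q) :
    Integrable (fun x => q x * ∫ y, u y * driftKernel ρ B x y) := by
  refine (integrable_prod_driftKernel hρ hB hBc hum hu hqm hq).integral_prod_left.congr
    (Eventually.of_forall fun x => ?_)
  simp only [← integral_const_mul]
  congr 1
  ext y
  ring

/-- The commutator between mollification and the transport term is controlled by the local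
oscillation. -/
theorem abs_integral_driftKernel_add_le (hρ : IsMollifier ρ ε) (hB : ContDiff ℝ 1 B)
    (hu : LocallyIntegrable u) {R R' D L : ℝ}
    (hR : ∀ x, ρ x ≤ R) (hR' : ∀ x, ‖fderiv ℝ ρ x‖ ≤ R') (hD : ∀ x, |divergence B x| ≤ D)
    (hL : ∀ x y, ‖B x - B y‖ ≤ L * ‖x - y‖) (hL0 : 0 ≤ L) (x : Rn n) :
    |(∫ y, u y * driftKernel ρ B x y) + fderiv ℝ (cv ρ u) x (B x)| ≤
      (R * D + R' * (L * ε)) * osc ε u x := by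
  have hR0 : 0 ≤ R := (hρ.nonneg 0).trans (hR 0)
  have hR0' : 0 ≤ R' := (norm_nonneg _).trans (hR' 0)
  have hBd : Differentiable ℝ B := hB.differentiable one_ne_zero
  -- Freezing the field at `x` in the gradient term turns the kernel into the divergence of `ρ (y -
  -- x) (B y - B x)`. Its integral vanishes, so `u y` may be replaced by `u y - u x`; the factor `B
  -- y - B x` supplies the power of `ε` that the gradient of `ρ` costs.
  set M : Rn n → ℝ := fun y => ρ (y - x) * divergence B y + fderiv ℝ ρ (y - x) (B y - B x)
    with hM
  have hsub : ContDiff ℝ 1 (fun y : Rn n => y - x) := contDiff_id.sub contDiff_const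
  have hG : ContDiff ℝ 1 (fun y => ρ (y - x) • (B y - B x)) :=
    (hρ.contDiff_one.comp hsub).smul (hB.sub contDiff_const)
  have hρx : HasCompactSupport (fun y => ρ (y - x)) := by
    have := hρ.hasCompactSupport.comp_homeomorph (Homeomorph.addRight (-x))
    simpa [sub_eq_add_neg, Function.comp_def] using this
  have hGc : HasCompactSupport (fun y => ρ (y - x) • (B y - B x)) := hρx.smul_right
  have hMdiv : ∀ y, divergence (fun y => ρ (y - x) • (B y - B x)) y = M y := by
    intro y
    have e1 : HasFDerivAt (fun y => ρ (y - x)) (fderiv ℝ ρ (y - x)) y := by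
      have := (hρ.differentiable (y - x)).hasFDerivAt.comp y ((hasFDerivAt_id y).sub_const x)
      rwa [ContinuousLinearMap.comp_id] at this
    have e2 : divergence (fun y => B y - B x) y = divergence B y := by
      simp only [divergence, fderiv_sub_const]
    rw [divergence_smul e1.differentiableAt ((hBd y).sub_const _), e1.fderiv, e2]
  have hM0 : ∫ y, M y = 0 := by
    simp_rw [← hMdiv]
    exact integral_divergence_eq_zero hG hGc
  have hMc : Continuous M := by
    have : M = divergence (fun y => ρ (y - x) • (B y - B x)) := funext fun y => (hMdiv y).symm
    rw [this]
    exact continuous_divergence hG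
  have hMcs : HasCompactSupport M := by
    have : M = divergence (fun y => ρ (y - x) • (B y - B x)) := funext fun y => (hMdiv y).symm
    rw [this]
    exact hasCompactSupport_divergence hGc
  have hMi : Integrable M := hMc.integrable_of_hasCompactSupport hMcs
  obtain ⟨A, hA⟩ := hMc.bounded_above_of_compact_support hMcs
  have huM : Integrable (fun y => u y * M y) := by
    simp_rw [mul_comm (u _)]
    exact integrable_mul_of_bounded_of_hasCompactSupport hu hMc.measurable hA hMcs
  have hud := hρ.integrable_mul_fderiv hu x (B x)
  have e1 : (∫ y, u y * driftKernel ρ B x y) + fderiv ℝ (cv ρ u) x (B x) =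
      ∫ y, (u y - u x) * M y := by
    have e2 : ∫ y, (u y - u x) * M y = ∫ y, u y * M y := by
      simp_rw [sub_mul]
      rw [integral_sub huM (hMi.const_mul _), integral_const_mul, hM0, mul_zero, sub_zero]
    -- The gradient of `ρ` is odd, so the frozen part is minus the integrand of `B(x) · ∇(ρ * u)(x)`
    -- and cancels the added term.
    have e3 : ∀ y, u y * driftKernel ρ B x y = u y * M y - u y * fderiv ℝ ρ (x - y) (B x) := by
      intro y
      have := hρ.fderiv_neg (y - x)
      rw [neg_sub] at this
      rw [this, driftKernel, hM]
      simp only [map_sub, neg_apply]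
      ring
    simp_rw [e3]
    rw [e2, integral_sub huM hud, hρ.fderiv_cv hu, sub_add_cancel]
  have hE : ∀ y, |M y| ≤ R * D + R' * (L * ε) := by
    intro y
    rcases lt_or_ge ε ‖y - x‖ with hlt | hle
    · have hε0 : M y = 0 := by simp [hM, hρ.eq_zero _ hlt, hρ.fderiv_eq_zero hlt]
      rw [hε0, abs_zero]
      have hD0 : 0 ≤ D := (abs_nonneg _).trans (hD 0)
      by_cases hε : 0 ≤ ε
      · positivity
      -- The sign of `ε` is not assumed; `ε < 0` would force `ρ = 0`, against its mass one.
      · exfalso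
        have hz : ρ = 0 := funext fun z => hρ.eq_zero z ((not_le.1 hε).trans_le (norm_nonneg z))
        have := hρ.integral_eq_one
        simp [hz] at this
    · refine (abs_add_le _ _).trans (add_le_add ?_ ?_)
      · rw [abs_mul, abs_of_nonneg (hρ.nonneg _)]
        exact mul_le_mul (hR _) (hD y) (abs_nonneg _) hR0
      · refine (ContinuousLinearMap.le_opNorm _ _).trans
          (mul_le_mul (hR' _) ((hL y x).trans ?_) (norm_nonneg _) hR0')
        gcongr
  rw [e1, ← integral_sub_left_eq_self _ volume x, osc, ← integral_const_mul,
    ← integral_indicator measurableSet_closedBall, ← Real.norm_eq_abs]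
  refine norm_integral_le_of_norm_le
    (IntegrableOn.integrable_indicator ((integrableOn_abs_sub hu ε x).const_mul _)
      measurableSet_closedBall)
    (Eventually.of_forall fun h => ?_)
  rw [norm_mul, Real.norm_eq_abs, Real.norm_eq_abs]
  by_cases hh : h ∈ Metric.closedBall (0 : Rn n) ε
  · rw [indicator_of_mem hh, mul_comm]
    gcongr
    exact hE _
  · have hlt : ε < ‖x - h - x‖ := by simpa using hh
    have hM1 : M (x - h) = 0 := by
      simp only [hM, hρ.eq_zero _ hlt, hρ.fderiv_eq_zero hlt, zero_mul, zero_apply, add_zero]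
    rw [indicator_of_notMem hh, hM1, abs_zero, mul_zero]

/-- The commutator bound integrated against a bounded `q`. No derivative falls on `q`, so
discontinuous cut-offs are allowed. -/
theorem integral_mul_divergence_cv_smul_le (hρ : IsMollifier ρ ε) (hB : ContDiff ℝ 1 B)
    (hBc : HasCompactSupport B) (hum : Measurable u) (hu : LocallyIntegrable u)
    (hqm : Measurable q) {A : ℝ} (hA : ∀ x, |q x| ≤ A) (hqc : HasCompactSupport q)
    {p Cq E : ℝ} (hCq : ∀ x, |q x| ≤ Cq * wt p x)
    (hE : ∀ x, |(∫ y, u y * driftKernel ρ B x y) + fderiv ℝ (cv ρ u) x (B x)| ≤ E * osc ε u x)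
    (hosc : Integrable (fun x => osc ε u x * wt p x)) :
    Integrable (fun x => q x * fderiv ℝ (cv ρ u) x (B x)) ∧
    ∫ y, u y * divergence (fun y => cv ρ q y • B y) y ≤
      - (∫ x, q x * fderiv ℝ (cv ρ u) x (B x)) + Cq * E * ∫ x, osc ε u x * wt p x := by
  have hq := integrable_of_bounded_of_hasCompactSupport hqm hA hqc
  have hc : Continuous (fun x => fderiv ℝ (cv ρ u) x (B x)) :=
    ((hρ.contDiff_cv hu).continuous_fderiv (by simp)).clm_apply hB.continuous
  have h1 : Integrable (fun x => q x * fderiv ℝ (cv ρ u) x (B x)) :=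
    integrable_mul_of_bounded_of_hasCompactSupport hc.locallyIntegrable hqm hA hqc
  refine ⟨h1, ?_⟩
  have h2 := integrable_mul_integral_driftKernel hρ hB hBc hum hu hqm hq
  rw [integral_mul_divergence_cv_smul hρ hB hBc hum hu hqm hq]
  have h3 : (∫ x, q x * ∫ y, u y * driftKernel ρ B x y) +
      (∫ x, q x * fderiv ℝ (cv ρ u) x (B x)) ≤ Cq * E * ∫ x, osc ε u x * wt p x := by
    rw [← integral_add h2 h1, ← integral_const_mul]
    refine integral_mono (h2.add h1) (hosc.const_mul _) fun x => ?_
    simp only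
    rw [← mul_add]
    refine (le_abs_self _).trans ?_
    rw [abs_mul]
    calc _ ≤ (Cq * wt p x) * (E * osc ε u x) :=
          mul_le_mul (hCq x) (hE x) (abs_nonneg _) ((abs_nonneg _).trans (hCq x))
      _ = _ := by ring
  linarith

/-- The transport term of the maximum of two mollified functions, tested against `φ`. -/
theorem integral_max_mul_divergence_ge (hρ : IsMollifier ρ ε) (hB : ContDiff ℝ 1 B)
    (hBc : HasCompactSupport B) {v : Rn n → ℝ} (hum : Measurable u) (hu : LocallyIntegrable u)
    (hvm : Measurable v) (hv : LocallyIntegrable v) {φ : Rn n → ℝ} (hφ : ContDiff ℝ 1 φ)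
    (hc : HasCompactSupport φ)
    {p C E : ℝ} (hC : ∀ x, |φ x| ≤ C * wt p x)
    (hEu : ∀ x, |(∫ y, u y * driftKernel ρ B x y) + fderiv ℝ (cv ρ u) x (B x)| ≤ E * osc ε u x)
    (hEv : ∀ x, |(∫ y, v y * driftKernel ρ B x y) + fderiv ℝ (cv ρ v) x (B x)| ≤ E * osc ε v x)
    (hou : Integrable (fun x => osc ε u x * wt p x))
    (hov : Integrable (fun x => osc ε v x * wt p x)) :
    (∫ y, u y * divergence
        (fun y => cv ρ ({y | cv ρ v y < cv ρ u y}.indicator φ) y • B y) y) +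
      (∫ y, v y * divergence
        (fun y => cv ρ ({y | cv ρ u y ≤ cv ρ v y}.indicator φ) y • B y) y) ≤
      (∫ x, max (cv ρ u x) (cv ρ v x) * divergence (fun y => φ y • B y) x) +
        C * E * ((∫ x, osc ε u x * wt p x) + ∫ x, osc ε v x * wt p x) := by
  obtain ⟨A, hA⟩ := hφ.continuous.bounded_above_of_compact_support hc
  have hUm : Measurable (cv ρ u) := measurable_cv hρ.measurable hum
  have hVm : Measurable (cv ρ v) := measurable_cv hρ.measurable hvm
  have hU : ContDiff ℝ 1 (cv ρ u) :=
    (hρ.contDiff_cv hu).of_le (WithTop.coe_le_coe.2 (le_top : (1 : ℕ∞) ≤ ⊤))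
  have hV : ContDiff ℝ 1 (cv ρ v) :=
    (hρ.contDiff_cv hv).of_le (WithTop.coe_le_coe.2 (le_top : (1 : ℕ∞) ≤ ⊤))
  have hF : ContDiff ℝ 1 (fun y => φ y • B y) := hφ.smul hB
  have hFc : HasCompactSupport (fun y => φ y • B y) := hc.smul_right
  set q₁ := {y | cv ρ v y < cv ρ u y}.indicator φ with hq₁
  set q₂ := {y | cv ρ u y ≤ cv ρ v y}.indicator φ with hq₂
  have hle : ∀ (S : Set (Rn n)) x, |S.indicator φ x| ≤ |φ x| := fun S x =>
    norm_indicator_le_norm_self φ x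
  obtain ⟨i₁, j₁⟩ := integral_mul_divergence_cv_smul_le (q := q₁) (A := A) (Cq := C) (p := p)
    hρ hB hBc hum hu
    (hφ.continuous.measurable.indicator (measurableSet_lt hVm hUm))
    (fun x => (hle _ x).trans (hA x)) (hasCompactSupport_indicator hc _)
    (fun x => (hle _ x).trans (hC x)) hEu hou
  obtain ⟨i₂, j₂⟩ := integral_mul_divergence_cv_smul_le (q := q₂) (A := A) (Cq := C) (p := p)
    hρ hB hBc hvm hv
    (hφ.continuous.measurable.indicator (measurableSet_le hUm hVm))
    (fun x => (hle _ x).trans (hA x)) (hasCompactSupport_indicator hc _)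
    (fun x => (hle _ x).trans (hC x)) hEv hov
  have hdiv := continuous_divergence hF
  have hdivc := hasCompactSupport_divergence hFc
  have k₁ := integral_mul_divergence hF hFc hV
  have k₂ := integral_max_zero_mul_divergence hF hFc (hU.sub hV)
  have hUd := hU.differentiable one_ne_zero
  have hVd := hV.differentiable one_ne_zero
  have m₁ : Integrable (fun x => cv ρ v x * divergence (fun y => φ y • B y) x) :=
    (hV.continuous.mul hdiv).integrable_of_hasCompactSupport hdivc.mul_left
  have m₂ : Integrable (fun x => max (cv ρ u x - cv ρ v x) 0 *
      divergence (fun y => φ y • B y) x) :=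
    (((hU.continuous.sub hV.continuous).max continuous_const).mul
      hdiv).integrable_of_hasCompactSupport hdivc.mul_left
  have m₃ : Integrable (fun x => fderiv ℝ (cv ρ v) x (φ x • B x)) := by
    refine ((hV.continuous_fderiv one_ne_zero).clm_apply
      hF.continuous).integrable_of_hasCompactSupport (hFc.mono fun x hx h0 => hx ?_)
    simp only at h0 ⊢
    rw [h0, map_zero]
  -- Write `max U V = V + (U - V)⁺`. The cut-offs then select exactly the gradient of the maximum,
  -- and both summands integrate by parts.
  have hsum : (∫ x, q₁ x * fderiv ℝ (cv ρ u) x (B x)) + (∫ x, q₂ x * fderiv ℝ (cv ρ v) x (B x)) =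
      - ∫ x, max (cv ρ u x) (cv ρ v x) * divergence (fun y => φ y • B y) x := by
    have e1 : ∫ x, max (cv ρ u x) (cv ρ v x) * divergence (fun y => φ y • B y) x =
        (∫ x, cv ρ v x * divergence (fun y => φ y • B y) x) +
          ∫ x, max (cv ρ u x - cv ρ v x) 0 * divergence (fun y => φ y • B y) x := by
      rw [← integral_add m₁ m₂]
      congr 1
      ext x
      rw [← add_mul]
      congr 1
      rw [← max_add_add_left, add_sub_cancel, add_zero]
    have e2 : ∀ x, q₁ x * fderiv ℝ (cv ρ u) x (B x) + q₂ x * fderiv ℝ (cv ρ v) x (B x) =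
        fderiv ℝ (cv ρ v) x (φ x • B x) +
          {y | 0 < cv ρ u y - cv ρ v y}.indicator
            (fun y => fderiv ℝ (fun y => cv ρ u y - cv ρ v y) y (φ y • B y)) x := by
      intro x
      have hsubd : fderiv ℝ (fun y => cv ρ u y - cv ρ v y) x =
          fderiv ℝ (cv ρ u) x - fderiv ℝ (cv ρ v) x := fderiv_fun_sub (hUd x) (hVd x)
      rcases lt_or_ge (cv ρ v x) (cv ρ u x) with hlt | hge
      · have a₁ : q₁ x = φ x := indicator_of_mem (by exact hlt) _
        have a₂ : q₂ x = 0 := indicator_of_notMem (by simpa using hlt) _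
        rw [a₁, a₂, indicator_of_mem (by simpa using hlt), hsubd]
        simp only [sub_apply, map_smul, smul_eq_mul]
        ring
      · have a₁ : q₁ x = 0 := indicator_of_notMem (by simpa using hge) _
        have a₂ : q₂ x = φ x := indicator_of_mem (by exact hge) _
        rw [a₁, a₂, indicator_of_notMem (by simpa using hge)]
        simp only [map_smul, smul_eq_mul]
        ring
    have m₄ : Integrable (fun x => {y | 0 < cv ρ u y - cv ρ v y}.indicator
        (fun y => fderiv ℝ (fun y => cv ρ u y - cv ρ v y) y (φ y • B y)) x) := by
      refine ((i₁.add i₂).sub m₃).congr (Eventually.of_forall fun x => ?_)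
      simp only [Pi.sub_apply, Pi.add_apply]
      rw [e2, add_sub_cancel_left]
    rw [← integral_add i₁ i₂]
    simp_rw [e2]
    rw [integral_add m₃ m₄, e1, k₁, k₂]
    ring
  rw [mul_add]
  linarith

end Drift

/-! ### Convergence of the mollifications -/

theorem IsMollifier.integrable_abs_cv_sub_mul_wt {ρ : Rn n → ℝ} {ε : ℝ} (hρ : IsMollifier ρ ε)
    (hε : ε ≤ 1) {p : ℝ} (hp : 0 ≤ p) {u : Rn n → ℝ} (hum : Measurable u)
    (hu : Integrable (fun x => u x * wt p x)) :
    Integrable (fun x => |cv ρ u x - u x| * wt p x) := by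
  refine ((hρ.integrable_cv_mul_wt hε hp hum hu).sub hu).abs.congr
    (Eventually.of_forall fun x => ?_)
  simp only [Pi.sub_apply]
  rw [← sub_mul, abs_mul, abs_of_pos (wt_pos p x)]

theorem tendsto_integral_abs_cv_sub {ρ : ℝ → Rn n → ℝ} {C : ℝ}
    (hρ : ∀ ε, 0 < ε → IsMollifier (ρ ε) ε) (hC : ∀ ε, 0 < ε → ∀ x, ρ ε x ≤ C * (ε ^ n)⁻¹)
    {p : ℝ} (hp : 0 ≤ p) {u : Rn n → ℝ} (hum : Measurable u)
    (hu : Integrable (fun x => u x * wt p x)) :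
    Tendsto (fun ε => ∫ x, |cv (ρ ε) u x - u x| * wt p x) (𝓝[>] 0) (𝓝 0) := by
  have h1 := (tendsto_integral_osc hp hum hu).const_mul C
  rw [mul_zero] at h1
  refine squeeze_zero' (Eventually.of_forall fun ε => integral_nonneg fun x =>
    mul_nonneg (abs_nonneg _) (wt_pos p x).le) ?_ h1
  filter_upwards [eventually_integrable_osc hp hum hu zero_lt_one, self_mem_nhdsWithin]
    with ε hε hε0
  rw [← mul_assoc, ← integral_const_mul]
  refine integral_mono_of_nonneg (Eventually.of_forall fun x =>
    mul_nonneg (abs_nonneg _) (wt_pos p x).le) (hε.1.const_mul _) (Eventually.of_forall fun x => ?_)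
  simp only
  rw [← mul_assoc]
  exact mul_le_mul_of_nonneg_right
    ((hρ ε hε0).abs_cv_sub_le (hC ε hε0) (locallyIntegrable_of_memL hp hu) x) (wt_pos p x).le

theorem integrable_mul_of_le_wt {p C : ℝ} {f k : Rn n → ℝ} (hk : Measurable k)
    (hC : ∀ x, |k x| ≤ C * wt p x) (hfm : Measurable f)
    (hf : Integrable (fun x => f x * wt p x)) : Integrable (fun x => f x * k x) := by
  refine (hf.norm.const_mul C).mono' (hfm.mul hk).aestronglyMeasurable
    (Eventually.of_forall fun x => ?_)
  rw [norm_mul, norm_mul, Real.norm_of_nonneg (wt_pos p x).le, mul_left_comm]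
  exact mul_le_mul_of_nonneg_left (hC x) (norm_nonneg _)

theorem tendsto_integral_mul_of_le_wt {ι : Type*} {l : Filter ι} {p C : ℝ} {f : ι → Rn n → ℝ}
    {g k : Rn n → ℝ} (hk : Measurable k) (hC : ∀ x, |k x| ≤ C * wt p x)
    (hfm : ∀ᶠ i in l, Measurable (f i)) (hf : ∀ᶠ i in l, Integrable (fun x => f i x * wt p x))
    (hgm : Measurable g) (hg : Integrable (fun x => g x * wt p x))
    (h : Tendsto (fun i => ∫ x, |f i x - g x| * wt p x) l (𝓝 0)) :
    Tendsto (fun i => ∫ x, f i x * k x) l (𝓝 (∫ x, g x * k x)) := by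
  rw [tendsto_iff_dist_tendsto_zero]
  have h1 := h.const_mul C
  rw [mul_zero] at h1
  refine squeeze_zero' (Eventually.of_forall fun i => dist_nonneg) ?_ h1
  filter_upwards [hfm, hf] with i him hi
  rw [Real.dist_eq, ← integral_sub (integrable_mul_of_le_wt hk hC him hi)
    (integrable_mul_of_le_wt hk hC hgm hg), ← integral_const_mul, ← Real.norm_eq_abs]
  have hd : Integrable (fun x => |f i x - g x| * wt p x) := by
    refine (hi.sub hg).abs.congr (Eventually.of_forall fun x => ?_)
    simp only [Pi.sub_apply]
    rw [← sub_mul, abs_mul, abs_of_pos (wt_pos p x)]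
  refine norm_integral_le_of_norm_le (hd.const_mul C) (Eventually.of_forall fun x => ?_)
  rw [← sub_mul, norm_mul, mul_left_comm]
  exact mul_le_mul_of_nonneg_left (hC x) (abs_nonneg _)

/-- Weighted `L¹` convergence gives convergence in measure, hence almost everywhere along a
sequence; the weight is positive and divides out. The filter is general so that the lemma applies
first to `ε → 0` and then along the sequence so obtained. -/
theorem exists_seq_tendsto_ae_of_integral {ι : Type*} {l : Filter ι} [l.NeBot]
    [l.IsCountablyGenerated] {p : ℝ} (hp : 0 ≤ p) {f : ι → Rn n → ℝ} {g : Rn n → ℝ}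
    (hfm : ∀ i, Measurable (f i)) (hgm : Measurable g)
    (hi : ∀ᶠ i in l, Integrable (fun x => |f i x - g x| * wt p x))
    (h : Tendsto (fun i => ∫ x, |f i x - g x| * wt p x) l (𝓝 0)) :
    ∃ ns : ℕ → ι, Tendsto ns atTop l ∧
      ∀ᵐ x, Tendsto (fun j => f (ns j) x) atTop (𝓝 (g x)) := by
  have hwm : Measurable (wt p : Rn n → ℝ) := (continuous_wt hp).measurable
  have hm : TendstoInMeasure volume (fun i x => |f i x - g x| * wt p x) l (fun _ => 0) := by
    refine tendstoInMeasure_of_tendsto_eLpNorm one_ne_zero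
      (fun i => (((hfm i).sub hgm).abs.mul hwm).aestronglyMeasurable)
      aestronglyMeasurable_const ?_
    have h1 := ENNReal.tendsto_ofReal h
    rw [ENNReal.ofReal_zero] at h1
    refine h1.congr' ?_
    filter_upwards [hi] with i hi
    rw [eLpNorm_one_eq_lintegral_enorm, integral_eq_lintegral_of_nonneg_ae
      (Eventually.of_forall fun x => mul_nonneg (abs_nonneg _) (wt_pos p x).le)
      hi.aestronglyMeasurable, ENNReal.ofReal_toReal]
    · refine lintegral_congr fun x => ?_
      simp only [Pi.sub_apply, sub_zero]
      rw [← Real.enorm_of_nonneg (mul_nonneg (abs_nonneg _) (wt_pos p x).le)]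
    · have := hi.hasFiniteIntegral
      rw [HasFiniteIntegral] at this
      refine ne_of_lt (lt_of_eq_of_lt (lintegral_congr fun x => ?_) this)
      rw [← Real.enorm_of_nonneg (mul_nonneg (abs_nonneg _) (wt_pos p x).le)]
  obtain ⟨ns, h1, h2⟩ := hm.exists_seq_tendsto_ae'
  refine ⟨ns, h1, ?_⟩
  filter_upwards [h2] with x hx
  rw [tendsto_iff_dist_tendsto_zero]
  have := hx.mul_const (wt p x)⁻¹
  rw [zero_mul] at this
  refine this.congr fun j => ?_
  rw [mul_inv_cancel_right₀ (wt_pos p x).ne', Real.dist_eq]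

/-- Move the mollifier from `q` onto `F`; replacing `ρ * F` by `F` costs an error depending on `q`
only through `C`, hence uniform over the cut-offs. -/
theorem IsMollifier.integral_mul_cv_le {ρ : Rn n → ℝ} {ε : ℝ} (hρ : IsMollifier ρ ε)
    (hε : ε ≤ 1) {p : ℝ} (hp : 0 ≤ p) {F q : Rn n → ℝ} (hFm : Measurable F) (hF : Integrable F)
    (hqm : Measurable q) {C : ℝ} (hC : ∀ x, |q x| ≤ C * wt p x) :
    ∫ x, F x * cv ρ q x ≤ (∫ x, F x * q x) + C * ∫ x, |cv ρ F x - F x| * wt p x := by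
  have hFw := memL_of_integrable hp hF
  rw [integral_mul_cv_eq hρ.even (hρ.integrable_prod_of_le_wt hε hp hFm hFw hqm hC)]
  have h1 := integrable_mul_of_le_wt hqm hC hFm hFw
  have h2 := integrable_mul_of_le_wt hqm hC (measurable_cv hρ.measurable hFm)
    (hρ.integrable_cv_mul_wt hε hp hFm hFw)
  rw [← integral_const_mul, ← integral_add h1
    ((hρ.integrable_abs_cv_sub_mul_wt hε hp hFm hFw).const_mul C)]
  simp_rw [mul_comm (q _)]
  refine integral_mono h2 (h1.add
    ((hρ.integrable_abs_cv_sub_mul_wt hε hp hFm hFw).const_mul C)) fun x => ?_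
  have h3 : (cv ρ F x - F x) * q x ≤ |cv ρ F x - F x| * (C * wt p x) := by
    refine (le_abs_self _).trans ?_
    rw [abs_mul]
    exact mul_le_mul_of_nonneg_left (hC x) (abs_nonneg _)
  simp only
  nlinarith

/-! ### The limit of the sources -/

theorem maxRhs_of_lt {u v F G : Rn n → ℝ} {x : Rn n} (h : v x < u x) : maxRhs u v F G x = F x := by
  simp [maxRhs, indicator, h, h.not_gt, h.ne']

theorem maxRhs_of_gt {u v F G : Rn n → ℝ} {x : Rn n} (h : u x < v x) : maxRhs u v F G x = G x := by
  simp [maxRhs, indicator, h, h.not_gt, h.ne]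

theorem maxRhs_of_eq {u v F G : Rn n → ℝ} {x : Rn n} (h : u x = v x) :
    maxRhs u v F G x = max (F x) (G x) := by
  simp [maxRhs, indicator, h]

/-- Where `u ≠ v` the strict inequality passes to `U j`, `V j` for large `j`, and dominated
convergence applies. Where `u = v` the cut-offs may oscillate with `j`, so the integrand is first
replaced by its upper bound `max F G * φ`. Hence a majorising sequence `a` rather than a limit of
the left-hand side. -/
theorem limit_source_le {U V : ℕ → Rn n → ℝ} {u v F G φ : Rn n → ℝ}
    (hUm : ∀ j, Measurable (U j)) (hVm : ∀ j, Measurable (V j)) (hum : Measurable u)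
    (hvm : Measurable v) (hFm : Measurable F) (hGm : Measurable G) (hF : Integrable F)
    (hG : Integrable G) (hφm : Measurable φ) (hφ0 : ∀ x, 0 ≤ φ x) {A : ℝ} (hA : ∀ x, |φ x| ≤ A)
    (hU : ∀ᵐ x, Tendsto (fun j => U j x) atTop (𝓝 (u x)))
    (hV : ∀ᵐ x, Tendsto (fun j => V j x) atTop (𝓝 (v x))) :
    ∃ a : ℕ → ℝ, Tendsto a atTop (𝓝 (∫ x, maxRhs u v F G x * φ x)) ∧
      ∀ j, (∫ x, F x * {y | V j y < U j y}.indicator φ x) +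
        (∫ x, G x * {y | U j y ≤ V j y}.indicator φ x) ≤ a j := by
  have hA0 : 0 ≤ A := (abs_nonneg _).trans (hA 0)
  have hm₁ : ∀ j, Measurable ({y | V j y < U j y}.indicator φ) := fun j =>
    hφm.indicator (measurableSet_lt (hVm j) (hUm j))
  have hm₂ : ∀ j, Measurable ({y | U j y ≤ V j y}.indicator φ) := fun j =>
    hφm.indicator (measurableSet_le (hUm j) (hVm j))
  set S : Set (Rn n) := {y | u y = v y} with hS
  have hSm : MeasurableSet S := measurableSet_eq_fun hum hvm
  let P : ℕ → Rn n → ℝ := fun j x => F x * {y | V j y < U j y}.indicator φ x +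
    G x * {y | U j y ≤ V j y}.indicator φ x
  let Q : ℕ → Rn n → ℝ := fun j x =>
    S.indicator (fun x => max (F x) (G x) * φ x) x + Sᶜ.indicator (P j) x
  have hi₁ : ∀ j, Integrable (fun x => F x * {y | V j y < U j y}.indicator φ x) := fun j =>
    hF.mul_bdd (c := A) (hm₁ j).aestronglyMeasurable
      (Eventually.of_forall fun x => (norm_indicator_le_norm_self φ x).trans (hA x))
  have hi₂ : ∀ j, Integrable (fun x => G x * {y | U j y ≤ V j y}.indicator φ x) := fun j =>
    hG.mul_bdd (c := A) (hm₂ j).aestronglyMeasurable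
      (Eventually.of_forall fun x => (norm_indicator_le_norm_self φ x).trans (hA x))
  have hPm : ∀ j, Measurable (P j) := fun j => (hFm.mul (hm₁ j)).add (hGm.mul (hm₂ j))
  have hQm : ∀ j, Measurable (Q j) := fun j =>
    (((hFm.max hGm).mul hφm).indicator hSm).add ((hPm j).indicator hSm.compl)
  have hPcase : ∀ j x, P j x = F x * φ x ∨ P j x = G x * φ x := by
    intro j x
    rcases lt_or_ge (V j x) (U j x) with h | h
    · left; simp [P, indicator, h, h.not_ge]
    · right; simp [P, indicator, h, h.not_gt]
  have hPle : ∀ j x, P j x ≤ max (F x) (G x) * φ x := by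
    intro j x
    rcases hPcase j x with h | h <;> rw [h]
    · exact mul_le_mul_of_nonneg_right (le_max_left _ _) (hφ0 x)
    · exact mul_le_mul_of_nonneg_right (le_max_right _ _) (hφ0 x)
  have hPQ : ∀ j x, P j x ≤ Q j x := by
    intro j x
    by_cases hx : x ∈ S
    · simp only [Q, indicator_of_mem hx, indicator_of_notMem (fun h : x ∈ Sᶜ => h hx), add_zero]
      exact hPle j x
    · simp only [Q, indicator_of_notMem hx, indicator_of_mem (show x ∈ Sᶜ from hx), zero_add,
        le_refl]
  have hbd : ∀ x, |F x * φ x| ≤ A * (|F x| + |G x|) ∧ |G x * φ x| ≤ A * (|F x| + |G x|) := by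
    intro x
    rw [abs_mul, abs_mul]
    have h1 := hA x
    have h2 := abs_nonneg (F x)
    have h3 := abs_nonneg (G x)
    constructor <;> nlinarith [abs_nonneg (φ x)]
  have hQle : ∀ j x, ‖Q j x‖ ≤ A * (|F x| + |G x|) := by
    intro j x
    rw [Real.norm_eq_abs]
    by_cases hx : x ∈ S
    · simp only [Q, indicator_of_mem hx, indicator_of_notMem (fun h : x ∈ Sᶜ => h hx), add_zero]
      rcases max_choice (F x) (G x) with h | h <;> rw [h]
      exacts [(hbd x).1, (hbd x).2]
    · simp only [Q, indicator_of_notMem hx, indicator_of_mem (show x ∈ Sᶜ from hx), zero_add]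
      rcases hPcase j x with h | h <;> rw [h]
      exacts [(hbd x).1, (hbd x).2]
  have hbi : Integrable (fun x => A * (|F x| + |G x|)) := (hF.abs.add hG.abs).const_mul A
  refine ⟨fun j => ∫ x, Q j x, ?_, fun j => ?_⟩
  · refine tendsto_integral_of_dominated_convergence _ (fun j => (hQm j).aestronglyMeasurable) hbi
      (fun j => Eventually.of_forall (hQle j)) ?_
    filter_upwards [hU, hV] with x hUx hVx
    refine tendsto_const_nhds.congr' ?_
    rcases lt_trichotomy (u x) (v x) with h | h | h
    · have hx : x ∉ S := h.ne
      filter_upwards [hUx.eventually_lt hVx h] with j hj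
      simp [Q, P, indicator, hx, hj.le, hj.not_gt, maxRhs_of_gt h]
    · refine Eventually.of_forall fun j => ?_
      have hx : x ∈ S := h
      simp [Q, indicator, hx, maxRhs_of_eq h]
    · have hx : x ∉ S := h.ne'
      filter_upwards [hVx.eventually_lt hUx h] with j hj
      simp [Q, P, indicator, hx, hj, hj.not_ge, maxRhs_of_lt h]
  · rw [← integral_add (hi₁ j) (hi₂ j)]
    exact integral_mono ((hi₁ j).add (hi₂ j))
      (hbi.mono' (hQm j).aestronglyMeasurable (Eventually.of_forall (hQle j))) (hPQ j)

/-! ### The inequality for a compactly supported drift -/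

/-- The inequality for the maximum, for a compactly supported drift on the whole space. -/
theorem max_subsolution_of_compactly_supported_drift (hn : 1 ≤ n) {s : ℝ} (hs0 : 0 < s)
    (hs1 : s < 1) {B : Rn n → Rn n} (hB : ContDiff ℝ 1 B) (hBc : HasCompactSupport B)
    {u v F G : Rn n → ℝ} (hum : Measurable u) (hvm : Measurable v) (hFm : Measurable F)
    (hGm : Measurable G) (hu : Integrable (fun x => u x * wt ((n : ℝ) + 2 * s) x))
    (hv : Integrable (fun x => v x * wt ((n : ℝ) + 2 * s) x)) (hF : Integrable F)
    (hG : Integrable G) {φ : Rn n → ℝ} (hφ : ContDiff ℝ (⊤ : ℕ∞) φ) (hc : HasCompactSupport φ)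
    (hφ0 : ∀ x, 0 ≤ φ x) {r : ℝ} (hr : 0 < r)
    (hsubu : ∀ ψ : Rn n → ℝ, ContDiff ℝ (⊤ : ℕ∞) ψ → HasCompactSupport ψ → (∀ x, 0 ≤ ψ x) →
      tsupport ψ ⊆ Metric.cthickening r (tsupport φ) →
      (∫ x, u x * fracLaplacian s ψ x) - (∫ x, u x * divergence (fun y => ψ y • B y) x) ≤
        ∫ x, F x * ψ x)
    (hsubv : ∀ ψ : Rn n → ℝ, ContDiff ℝ (⊤ : ℕ∞) ψ → HasCompactSupport ψ → (∀ x, 0 ≤ ψ x) →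
      tsupport ψ ⊆ Metric.cthickening r (tsupport φ) →
      (∫ x, v x * fracLaplacian s ψ x) - (∫ x, v x * divergence (fun y => ψ y • B y) x) ≤
        ∫ x, G x * ψ x) :
    (∫ x, max (u x) (v x) * fracLaplacian s φ x) -
      (∫ x, max (u x) (v x) * divergence (fun y => φ y • B y) x) ≤
        ∫ x, maxRhs u v F G x * φ x := by
  set p : ℝ := (n : ℝ) + 2 * s with hpdef
  have hp : 0 ≤ p := by positivity
  have hφ2 : ContDiff ℝ 2 φ := hφ.of_le (WithTop.coe_le_coe.2 (le_top : (2 : ℕ∞) ≤ ⊤))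
  have hφ1 : ContDiff ℝ 1 φ := hφ.of_le (WithTop.coe_le_coe.2 (le_top : (1 : ℕ∞) ≤ ⊤))
  have hφm := hφ.continuous.measurable
  have hul := locallyIntegrable_of_memL hp hu
  have hvl := locallyIntegrable_of_memL hp hv
  obtain ⟨A, hA⟩ := hφ.continuous.bounded_above_of_compact_support hc
  obtain ⟨C, hC0, hC⟩ := exists_le_wt_of_hasCompactSupport hp hA hc
  obtain ⟨K, hK0, hmol⟩ := exists_isMollifier n
  choose! ρ hρ hρK hρK' using hmol
  obtain ⟨D, hD⟩ := (continuous_divergence hB).bounded_above_of_compact_support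
    (hasCompactSupport_divergence hBc)
  obtain ⟨L, hL⟩ := hB.lipschitzWith_of_hasCompactSupport hBc one_ne_zero
  have hL' : ∀ x y, ‖B x - B y‖ ≤ L * ‖x - y‖ := fun x y => by
    simpa [dist_eq_norm] using hL.dist_le_mul x y
  have hdivm : Measurable (divergence (fun y => φ y • B y)) :=
    (continuous_divergence (hφ1.smul hB)).measurable
  have hdivc : HasCompactSupport (divergence (fun y => φ y • B y)) :=
    hasCompactSupport_divergence hc.smul_right
  obtain ⟨Ad, hAd⟩ := (continuous_divergence (hφ1.smul hB)).bounded_above_of_compact_support hdivc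
  obtain ⟨Cd, hCd0, hCd⟩ := exists_le_wt_of_hasCompactSupport hp hAd hdivc
  obtain ⟨Cl, hCl0, hCl⟩ := exists_fracLaplacian_le hn hs0 hs1 hφ2 hc
  have hlapm := measurable_fracLaplacian hn hs0 hs1 hφ2 hc
  have hcvm : ∀ {g : Rn n → ℝ}, Measurable g → ∀ ε, 0 < ε → Measurable (cv (ρ ε) g) :=
    fun hg ε hε => measurable_cv (hρ ε hε).measurable hg
  have hε1 : ∀ᶠ ε in 𝓝[>] (0 : ℝ), ε ≤ 1 :=
    (eventually_le_nhds zero_lt_one).filter_mono nhdsWithin_le_nhds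
  have hεr : ∀ᶠ ε in 𝓝[>] (0 : ℝ), ε ≤ r :=
    (eventually_le_nhds hr).filter_mono nhdsWithin_le_nhds
  have hε0 : ∀ᶠ ε in 𝓝[>] (0 : ℝ), 0 < ε := self_mem_nhdsWithin
  -- convergence of the mollifications
  have tu := tendsto_integral_abs_cv_sub hρ hρK hp hum hu
  have tv := tendsto_integral_abs_cv_sub hρ hρK hp hvm hv
  have tF := tendsto_integral_abs_cv_sub hρ hρK hp hFm (memL_of_integrable hp hF)
  have tG := tendsto_integral_abs_cv_sub hρ hρK hp hGm (memL_of_integrable hp hG)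
  have tw : Tendsto (fun ε => ∫ x, |max (cv (ρ ε) u x) (cv (ρ ε) v x) - max (u x) (v x)| * wt p x)
      (𝓝[>] 0) (𝓝 0) := by
    have h1 := tu.add tv
    rw [add_zero] at h1
    refine squeeze_zero' (Eventually.of_forall fun ε => integral_nonneg fun x =>
      mul_nonneg (abs_nonneg _) (wt_pos p x).le) ?_ h1
    filter_upwards [hε1, hε0] with ε hε1 hε0
    have a := (hρ ε hε0).integrable_abs_cv_sub_mul_wt hε1 hp hum hu
    have b := (hρ ε hε0).integrable_abs_cv_sub_mul_wt hε1 hp hvm hv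
    rw [← integral_add a b]
    refine integral_mono_of_nonneg (Eventually.of_forall fun x =>
      mul_nonneg (abs_nonneg _) (wt_pos p x).le) (a.add b) (Eventually.of_forall fun x => ?_)
    simp only
    rw [← add_mul]
    refine mul_le_mul_of_nonneg_right ?_ (wt_pos p x).le
    refine (abs_max_sub_max_le_max _ _ _ _).trans (max_le ?_ ?_)
    · linarith [abs_nonneg (cv (ρ ε) v x - v x)]
    · linarith [abs_nonneg (cv (ρ ε) u x - u x)]
  have hwmeas : ∀ᶠ ε in 𝓝[>] (0 : ℝ),
      Measurable (fun x => max (cv (ρ ε) u x) (cv (ρ ε) v x)) := by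
    filter_upwards [hε0] with ε hε0 using (hcvm hum ε hε0).max (hcvm hvm ε hε0)
  have hwint : ∀ᶠ ε in 𝓝[>] (0 : ℝ),
      Integrable (fun x => max (cv (ρ ε) u x) (cv (ρ ε) v x) * wt p x) := by
    filter_upwards [hε0, hε1] with ε hε0 hε1 using integrable_max_mul_wt
      ((hρ ε hε0).integrable_cv_mul_wt hε1 hp hum hu)
      ((hρ ε hε0).integrable_cv_mul_wt hε1 hp hvm hv)
  have tlap := tendsto_integral_mul_of_le_wt hlapm hCl hwmeas hwint (hum.max hvm)
    (integrable_max_mul_wt hu hv) tw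
  have tdiv := tendsto_integral_mul_of_le_wt hdivm hCd hwmeas hwint (hum.max hvm)
    (integrable_max_mul_wt hu hv) tw
  -- the error term
  let err : ℝ → ℝ := fun ε =>
    C * (K * (D + L)) * ((ε ^ n)⁻¹ * (∫ x, osc ε u x * wt p x) +
      (ε ^ n)⁻¹ * ∫ x, osc ε v x * wt p x) +
    C * ((∫ x, |cv (ρ ε) F x - F x| * wt p x) + ∫ x, |cv (ρ ε) G x - G x| * wt p x)
  have terr : Tendsto err (𝓝[>] 0) (𝓝 0) := by
    have := (((tendsto_integral_osc hp hum hu).add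
      (tendsto_integral_osc hp hvm hv)).const_mul (C * (K * (D + L)))).add
      ((tF.add tG).const_mul C)
    simpa using this
  have hD0 : 0 ≤ D := (norm_nonneg _).trans (hD 0)
  have main : ∀ᶠ ε in 𝓝[>] (0 : ℝ),
      (∫ x, max (cv (ρ ε) u x) (cv (ρ ε) v x) * fracLaplacian s φ x) -
      (∫ x, max (cv (ρ ε) u x) (cv (ρ ε) v x) * divergence (fun y => φ y • B y) x) ≤
        ((∫ x, F x * {y | cv (ρ ε) v y < cv (ρ ε) u y}.indicator φ x) +
        (∫ x, G x * {y | cv (ρ ε) u y ≤ cv (ρ ε) v y}.indicator φ x)) + err ε := by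
    filter_upwards [hε0, hε1, hεr, eventually_integrable_osc hp hum hu zero_lt_one,
      eventually_integrable_osc hp hvm hv zero_lt_one] with ε hε0 hε1 hεr hou hov
    have hm := hρ ε hε0
    -- The factor `L * ε` from the Lipschitz bound on `B` cancels the `ε⁻¹` of the mollifier
    -- gradient. What is left is the averaging factor `ε^(-n)`, for which the oscillation tends to
    -- zero.
    have hE : K * (ε ^ n)⁻¹ * D + K * (ε ^ n)⁻¹ * ε⁻¹ * (L * ε) =
        K * (D + L) * (ε ^ n)⁻¹ := by
      field_simp
    have hEu := abs_integral_driftKernel_add_le hm hB hul (hρK ε hε0) (hρK' ε hε0) hD hL' L.2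
    have hEv := abs_integral_driftKernel_add_le hm hB hvl (hρK ε hε0) (hρK' ε hε0) hD hL' L.2
    rw [hE] at hEu hEv
    have hfrac := integral_max_mul_fracLaplacian_le hn hs0 hs1 hm hε1 hum hu hvm hv hφ2 hc hφ0
    have hdrift := integral_max_mul_divergence_ge hm hB hBc hum hul hvm hvl hφ1 hc hC hEu hEv
      hou.1 hov.1
    set q₁ := {y | cv (ρ ε) v y < cv (ρ ε) u y}.indicator φ
    set q₂ := {y | cv (ρ ε) u y ≤ cv (ρ ε) v y}.indicator φ
    have hqc : ∀ S : Set (Rn n), HasCompactSupport (S.indicator φ) :=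
      fun S => hasCompactSupport_indicator hc S
    have hq₁m : Measurable q₁ := hφm.indicator (measurableSet_lt (hcvm hvm ε hε0) (hcvm hum ε hε0))
    have hq₂m : Measurable q₂ := hφm.indicator (measurableSet_le (hcvm hum ε hε0) (hcvm hvm ε hε0))
    have hq0 : ∀ (S : Set (Rn n)) x, 0 ≤ S.indicator φ x :=
      fun S x => indicator_nonneg (fun y _ => hφ0 y) x
    have hqle : ∀ (S : Set (Rn n)) x, |S.indicator φ x| ≤ |φ x| := fun S x =>
      norm_indicator_le_norm_self φ x
    have hts : ∀ S : Set (Rn n), tsupport (cv (ρ ε) (S.indicator φ)) ⊆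
        Metric.cthickening r (tsupport φ) := fun S => by
      refine hm.tsupport_cv_subset.trans ((Metric.cthickening_mono hεr _).trans
        (Metric.cthickening_subset_of_subset r (closure_mono ?_)))
      rw [support_indicator]
      exact inter_subset_right
    have hq₁i := integrable_of_bounded_of_hasCompactSupport hq₁m
      (fun x => (hqle _ x).trans (hA x)) (hqc _)
    have hq₂i := integrable_of_bounded_of_hasCompactSupport hq₂m
      (fun x => (hqle _ x).trans (hA x)) (hqc _)
    have su := hsubu _ (hm.contDiff_cv hq₁i.locallyIntegrable) (hm.hasCompactSupport_cv (hqc _))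
      (hm.cv_nonneg (hq0 _)) (hts _)
    have sv := hsubv _ (hm.contDiff_cv hq₂i.locallyIntegrable) (hm.hasCompactSupport_cv (hqc _))
      (hm.cv_nonneg (hq0 _)) (hts _)
    have iu := hm.integral_mul_cv_le hε1 hp hFm hF hq₁m (fun x => (hqle _ x).trans (hC x))
    have iv := hm.integral_mul_cv_le hε1 hp hGm hG hq₂m (fun x => (hqle _ x).trans (hC x))
    have herr : err ε = C * (K * (D + L) * (ε ^ n)⁻¹) * ((∫ x, osc ε u x * wt p x) +
        ∫ x, osc ε v x * wt p x) + (C * (∫ x, |cv (ρ ε) F x - F x| * wt p x) +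
        C * ∫ x, |cv (ρ ε) G x - G x| * wt p x) := by
      simp only [err]
      ring
    rw [herr]
    linarith
  -- a sequence along which the mollifications converge almost everywhere
  let ε' : ℝ → ℝ := fun ε => if 0 < ε then ε else 1
  -- Nothing is known about `ρ ε` for `ε ≤ 0`; the default scale `1` makes every member of the
  -- family measurable without changing it near `0⁺`.
  have hε' : ∀ ε, 0 < ε' ε := fun ε => by
    simp only [ε']
    split_ifs with h
    exacts [h, one_pos]
  have hε'eq : ∀ᶠ ε in 𝓝[>] (0 : ℝ), ε' ε = ε := by
    filter_upwards [hε0] with ε h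
    simp [ε', h]
  have aeu : ∃ ns : ℕ → ℝ, Tendsto ns atTop (𝓝[>] 0) ∧
      ∀ᵐ x, Tendsto (fun j => cv (ρ (ε' (ns j))) u x) atTop (𝓝 (u x)) := by
    refine exists_seq_tendsto_ae_of_integral hp (f := fun ε => cv (ρ (ε' ε)) u)
      (fun ε => hcvm hum _ (hε' ε)) hum ?_ (tu.congr' ?_)
    · filter_upwards [hε0, hε1, hε'eq] with ε h0 h1 h
      rw [h]
      exact (hρ ε h0).integrable_abs_cv_sub_mul_wt h1 hp hum hu
    · filter_upwards [hε'eq] with ε h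
      rw [h]
  obtain ⟨ns, hns, hnsu⟩ := aeu
  have aev : ∃ ms : ℕ → ℕ, Tendsto ms atTop atTop ∧
      ∀ᵐ x, Tendsto (fun j => cv (ρ (ε' (ns (ms j)))) v x) atTop (𝓝 (v x)) := by
    refine exists_seq_tendsto_ae_of_integral hp (f := fun i => cv (ρ (ε' (ns i))) v)
      (fun i => hcvm hvm _ (hε' _)) hvm ?_ ((tv.comp hns).congr' ?_)
    · filter_upwards [hns.eventually hε0, hns.eventually hε1, hns.eventually hε'eq] with i h0 h1 h
      rw [h]
      exact (hρ _ h0).integrable_abs_cv_sub_mul_wt h1 hp hvm hv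
    · filter_upwards [hns.eventually hε'eq] with i h
      rw [Function.comp_apply, h]
  obtain ⟨ms, hms, hmsv⟩ := aev
  have hseq : Tendsto (fun j => ns (ms j)) atTop (𝓝[>] 0) := hns.comp hms
  obtain ⟨a, ha, hale⟩ := limit_source_le (F := F) (G := G) (φ := φ)
    (U := fun j => cv (ρ (ε' (ns (ms j)))) u) (V := fun j => cv (ρ (ε' (ns (ms j)))) v)
    (fun j => hcvm hum _ (hε' _)) (fun j => hcvm hvm _ (hε' _)) hum hvm hFm hGm hF hG hφm hφ0 hA
    (by filter_upwards [hnsu] with x hx using hx.comp hms) hmsv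
  have hlim := ha.add (terr.comp hseq)
  rw [add_zero] at hlim
  refine le_of_tendsto_of_tendsto ((tlap.sub tdiv).comp hseq) hlim ?_
  filter_upwards [hseq.eventually main, hseq.eventually hε'eq] with j hj hej
  have := hale j
  rw [hej] at this
  exact hj.trans (add_le_add this le_rfl)

/-! ### Reduction to measurable representatives and compactly supported drift -/

theorem MemL.aestronglyMeasurable {s : ℝ} (hs : 0 < s) {u : Rn n → ℝ} (hu : MemL (2 * s) u) :
    AEStronglyMeasurable u := by
  have hp : 0 ≤ (n : ℝ) + 2 * s := by positivity
  exact (locallyIntegrable_of_memL hp (memL_iff.1 hu)).aestronglyMeasurable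

theorem abs_maxRhs_le (u v f g : Rn n → ℝ) (x : Rn n) : |maxRhs u v f g x| ≤ |f x| + |g x| := by
  have h1 := abs_nonneg (f x)
  have h2 := abs_nonneg (g x)
  rcases lt_trichotomy (u x) (v x) with h | h | h
  · rw [maxRhs_of_gt h]; linarith
  · rw [maxRhs_of_eq h]
    rcases max_choice (f x) (g x) with e | e <;> rw [e] <;> linarith
  · rw [maxRhs_of_lt h]; linarith

theorem integrableOn_maxRhs {u v f g : Rn n → ℝ} (hu : AEStronglyMeasurable u)
    (hv : AEStronglyMeasurable v) {K : Set (Rn n)} (hf : IntegrableOn f K)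
    (hg : IntegrableOn g K) : IntegrableOn (maxRhs u v f g) K := by
  have hum := hu.aemeasurable.restrict (s := K)
  have hvm := hv.aemeasurable.restrict (s := K)
  refine Integrable.mono' (Integrable.add hf.abs hg.abs) ?_
    (Eventually.of_forall (abs_maxRhs_le u v f g))
  exact ((hf.aestronglyMeasurable.indicator₀ (nullMeasurableSet_lt hvm hum)).add
    (hg.aestronglyMeasurable.indicator₀ (nullMeasurableSet_lt hum hvm))).add
    ((hf.aestronglyMeasurable.sup hg.aestronglyMeasurable).indicator₀
      (nullMeasurableSet_eq_fun hum hvm))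

theorem locallyIntegrableOn_maxRhs {u v f g : Rn n → ℝ} (hu : AEStronglyMeasurable u)
    (hv : AEStronglyMeasurable v) {Ω : Opens (Rn n)}
    (hf : LocallyIntegrableOn f (Ω : Set (Rn n))) (hg : LocallyIntegrableOn g (Ω : Set (Rn n))) :
    LocallyIntegrableOn (maxRhs u v f g) (Ω : Set (Rn n)) := by
  rw [locallyIntegrableOn_iff Ω.isOpen.isLocallyClosed]
  intro K hKΩ hK
  exact integrableOn_maxRhs hu hv (hf.integrableOn_compact_subset hKΩ hK)
    (hg.integrableOn_compact_subset hKΩ hK)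

theorem contDiff_smul_of_tsupport_subset {Ω : Opens (Rn n)} {χ : Rn n → ℝ} {b : Rn n → Rn n}
    (hχ : ContDiff ℝ (⊤ : ℕ∞) χ) (hsub : tsupport χ ⊆ Ω)
    (hb : ContDiffOn ℝ 1 b (Ω : Set (Rn n))) : ContDiff ℝ 1 (fun x => χ x • b x) := by
  rw [contDiff_iff_contDiffAt]
  intro x
  by_cases hx : x ∈ tsupport χ
  · exact ((hχ.of_le (WithTop.coe_le_coe.2 (le_top : (1 : ℕ∞) ≤ ⊤))).contDiffAt).smul
      (hb.contDiffAt (Ω.isOpen.mem_nhds (hsub hx)))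
  · have : (fun x => χ x • b x) =ᶠ[𝓝 x] fun _ => 0 := by
      filter_upwards [(isClosed_tsupport χ).isOpen_compl.mem_nhds hx] with y hy
      rw [image_eq_zero_of_notMem_tsupport hy, zero_smul]
    exact contDiffAt_const.congr_of_eventuallyEq this

theorem integrableOn_mul_of_memLp_top {Ω : Opens (Rn n)} {c w : Rn n → ℝ}
    (hc : MemLp c ∞ (volume.restrict (Ω : Set (Rn n)))) {K : Set (Rn n)} (hKΩ : K ⊆ Ω)
    (hw : IntegrableOn w K) : IntegrableOn (fun x => c x * w x) K :=
  Integrable.mul_of_top_right hw (hc.mono_measure (Measure.restrict_mono hKΩ le_rfl))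

theorem setIntegral_mul_eq_indicator {Ω K : Set (Rn n)} (hKΩ : K ⊆ Ω)
    {ψ h : Rn n → ℝ} (hψ : tsupport ψ ⊆ K) :
    ∫ x in Ω, h x * ψ x = ∫ x, K.indicator h x * ψ x := by
  have h0 : ∀ x, x ∉ K → ψ x = 0 := fun x hx => image_eq_zero_of_notMem_tsupport fun h => hx (hψ h)
  rw [setIntegral_eq_integral_of_forall_compl_eq_zero fun x hx => by
    rw [h0 x fun h => hx (hKΩ h), mul_zero]]
  congr 1
  ext x
  by_cases hx : x ∈ K
  · rw [indicator_of_mem hx]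
  · rw [h0 x hx, mul_zero, mul_zero]

theorem funDistr_sub_eq {Ω : Opens (Rn n)} {K : Set (Rn n)} (hK : MeasurableSet K)
    (hKΩ : K ⊆ Ω) {c w h : Rn n → ℝ} (hh : IntegrableOn h K)
    (hcw : IntegrableOn (fun x => c x * w x) K) {ψ : 𝓓(Ω, ℝ)} (hψ : tsupport ψ ⊆ K) :
    funDistr h ψ - funDistr (fun x => c x * w x) ψ =
      ∫ x, K.indicator (fun x => h x - c x * w x) x * ψ x := by
  obtain ⟨A, hA⟩ := ψ.continuous.bounded_above_of_compact_support ψ.hasCompactSupport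
  have hi : ∀ {k : Rn n → ℝ}, IntegrableOn k K → Integrable (fun x => K.indicator k x * ψ x) :=
    fun hk => (hk.integrable_indicator hK).mul_bdd (c := A) ψ.continuous.aestronglyMeasurable
      (Eventually.of_forall hA)
  unfold funDistr
  rw [setIntegral_mul_eq_indicator hKΩ hψ, setIntegral_mul_eq_indicator hKΩ hψ,
    ← integral_sub (hi hh) (hi hcw)]
  congr 1
  ext x
  rw [← sub_mul]
  congr 1
  by_cases hx : x ∈ K <;> simp [indicator, hx]

/-- For test functions supported in `K` the drift may be multiplied by a cut-off equal to `1` on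
`K`. This makes it a `C¹` field on the whole space, and the integral over `Ω` becomes one over the
whole space. -/
theorem driftDistr_eq {Ω : Opens (Rn n)} {K : Set (Rn n)} (hKΩ : K ⊆ Ω) {χ : Rn n → ℝ}
    (hχ : ∀ x ∈ K, χ x = 1) (b : Rn n → Rn n) (w : Rn n → ℝ) {ψ : 𝓓(Ω, ℝ)}
    (hψ : tsupport ψ ⊆ K) :
    driftDistr b w ψ = - ∫ x, w x * divergence (fun y => ψ y • (χ y • b y)) x := by
  have e : (fun y => ψ y • b y) = fun y => ψ y • (χ y • b y) := by
    ext1 y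
    by_cases hy : y ∈ K
    · rw [hχ y hy, one_smul]
    · rw [image_eq_zero_of_notMem_tsupport fun h => hy (hψ h), zero_smul, zero_smul]
  rw [driftDistr, e, setIntegral_eq_integral_of_forall_compl_eq_zero]
  intro x hx
  rw [divergence_eq_zero_of_notMem, mul_zero]
  intro hmem
  refine hx (hKΩ (hψ ?_))
  have hsub : Function.support (fun y => ψ y • (χ y • b y)) ⊆ Function.support ψ := by
    intro y hy h0
    exact hy (by simp only [h0, zero_smul])
  exact closure_mono hsub hmem

/-- The subsolution inequality in terms of a measurable representative and a compactly supported
drift. -/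
theorem subsolution_iff_of_tsupport_subset {Ω : Opens (Rn n)} {s : ℝ} {K : Set (Rn n)}
    (hK : MeasurableSet K) (hKΩ : K ⊆ Ω) {χ : Rn n → ℝ} (hχ : ∀ x ∈ K, χ x = 1)
    (b : Rn n → Rn n) {c w w' h H : Rn n → ℝ} (hw : w =ᵐ[volume] w') (hh : IntegrableOn h K)
    (hcw : IntegrableOn (fun x => c x * w x) K) {ψ : 𝓓(Ω, ℝ)} (hψ : tsupport ψ ⊆ K)
    (hH : ∀ᵐ x, K.indicator (fun x => h x - c x * w x) x * ψ x = H x * ψ x) :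
    fracLaplacianDistr s w ψ + driftDistr b w ψ + funDistr (fun x => c x * w x) ψ ≤ funDistr h ψ ↔
      (∫ x, w' x * fracLaplacian s ψ x) -
        (∫ x, w' x * divergence (fun y => ψ y • (χ y • b y)) x) ≤ ∫ x, H x * ψ x := by
  have e1 : fracLaplacianDistr s w ψ = ∫ x, w' x * fracLaplacian s ψ x := by
    refine integral_congr_ae ?_
    filter_upwards [hw] with x hx
    rw [hx]
  have e2 : driftDistr b w ψ = - ∫ x, w' x * divergence (fun y => ψ y • (χ y • b y)) x := by
    rw [driftDistr_eq hKΩ hχ b w hψ]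
    congr 1
    refine integral_congr_ae ?_
    filter_upwards [hw] with x hx
    rw [hx]
  have e3 := funDistr_sub_eq hK hKΩ hh hcw hψ
  rw [integral_congr_ae hH] at e3
  rw [e1, e2]
  constructor <;> intro h <;> linarith

/-- For one `φ` only a compact neighbourhood `K` of its support matters: there `b` is cut off, the
sources are integrable after subtracting the zero-order terms, and all functions are replaced by
measurable representatives. -/
theorem isSubsolution_max (hn : 1 ≤ n) {s : ℝ} (hs0 : 0 < s) (hs1 : s < 1)
    {Ω : Opens (Rn n)} {b : Rn n → Rn n} (hb : ContDiffOn ℝ 1 b (Ω : Set (Rn n)))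
    {c : Rn n → ℝ} (hc : MemLp c ∞ (volume.restrict (Ω : Set (Rn n))))
    {u v f g : Rn n → ℝ} (hu : MemL (2 * s) u) (hv : MemL (2 * s) v)
    (hf : LocallyIntegrableOn f (Ω : Set (Rn n))) (hg : LocallyIntegrableOn g (Ω : Set (Rn n)))
    (hsubu : IsSubsolution Ω s b c u f) (hsubv : IsSubsolution Ω s b c v g) :
    IsSubsolution Ω s b c (fun x => max (u x) (v x)) (maxRhs u v f g) := by
  intro φ hφ0
  have hp : 0 ≤ (n : ℝ) + 2 * s := by positivity
  -- The margin `r` is the room that mollified cut-offs of `φ` need in order to remain test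
  -- functions on `Ω`.
  obtain ⟨r, hr, hrΩ⟩ := φ.hasCompactSupport.isCompact.exists_cthickening_subset_open Ω.isOpen
    φ.tsupport_subset
  set K : Set (Rn n) := Metric.cthickening r (tsupport φ) with hKdef
  have hKc : IsCompact K := φ.hasCompactSupport.isCompact.cthickening
  have hKm : MeasurableSet K := hKc.measurableSet
  have hφK : tsupport φ ⊆ K := Metric.self_subset_cthickening _
  obtain ⟨χ, hχ, hχc, hχΩ, hχ1⟩ := exists_cutoff hKc Ω.isOpen hrΩ
  have hχ1' : ∀ x ∈ K, χ x = 1 := fun x hx => hχ1.self_of_nhdsSet x hx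
  have hB := contDiff_smul_of_tsupport_subset hχ hχΩ hb
  have hBc : HasCompactSupport (fun x => χ x • b x) := hχc.smul_right
  have hum := hu.aestronglyMeasurable hs0
  have hvm := hv.aestronglyMeasurable hs0
  have hul := locallyIntegrable_of_memL hp (memL_iff.1 hu)
  have hvl := locallyIntegrable_of_memL hp (memL_iff.1 hv)
  obtain ⟨u', hum', huu'⟩ := hum.aemeasurable
  obtain ⟨v', hvm', hvv'⟩ := hvm.aemeasurable
  have hu' : Integrable (fun x => u' x * wt ((n : ℝ) + 2 * s) x) :=
    (memL_iff.1 hu).congr (by filter_upwards [huu'] with x hx; rw [hx])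
  have hv' : Integrable (fun x => v' x * wt ((n : ℝ) + 2 * s) x) :=
    (memL_iff.1 hv).congr (by filter_upwards [hvv'] with x hx; rw [hx])
  have hfK := hf.integrableOn_compact_subset hrΩ hKc
  have hgK := hg.integrableOn_compact_subset hrΩ hKc
  have hcu : IntegrableOn (fun x => c x * u x) K :=
    integrableOn_mul_of_memLp_top hc hrΩ (hul.integrableOn_isCompact hKc)
  have hcv : IntegrableOn (fun x => c x * v x) K :=
    integrableOn_mul_of_memLp_top hc hrΩ (hvl.integrableOn_isCompact hKc)
  have hcw : IntegrableOn (fun x => c x * max (u x) (v x)) K :=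
    integrableOn_mul_of_memLp_top hc hrΩ
      (Integrable.sup (hul.integrableOn_isCompact hKc) (hvl.integrableOn_isCompact hKc))
  have hF : Integrable (K.indicator fun x => f x - c x * u x) :=
    IntegrableOn.integrable_indicator (Integrable.sub hfK hcu) hKm
  have hG : Integrable (K.indicator fun x => g x - c x * v x) :=
    IntegrableOn.integrable_indicator (Integrable.sub hgK hcv) hKm
  obtain ⟨F, hFm, hFF⟩ := hF.aestronglyMeasurable.aemeasurable
  obtain ⟨G, hGm, hGG⟩ := hG.aestronglyMeasurable.aemeasurable
  have hw : (fun x => max (u x) (v x)) =ᵐ[volume] fun x => max (u' x) (v' x) := by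
    filter_upwards [huu', hvv'] with x h1 h2
    rw [h1, h2]
  -- The zero-order term is compatible with the maximum: on `{u = v}` the same `c u` is subtracted
  -- from `f` and `g`, so it comes out of the maximum; elsewhere one function is selected
  -- throughout. No sign of `c` is involved.
  have hH : ∀ᵐ x, K.indicator (fun x => maxRhs u v f g x - c x * max (u x) (v x)) x * φ x =
      maxRhs u' v' F G x * φ x := by
    filter_upwards [huu', hvv', hFF, hGG] with x h1 h2 h3 h4
    by_cases hx : x ∈ K
    · congr 1
      rw [indicator_of_mem hx] at h3 h4 ⊢
      rcases lt_trichotomy (u x) (v x) with h | h | h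
      · rw [maxRhs_of_gt h, maxRhs_of_gt (by rwa [← h1, ← h2]), max_eq_right h.le, h4]
      · rw [maxRhs_of_eq h, maxRhs_of_eq (by rwa [← h1, ← h2]), ← h3, ← h4, h, max_self,
          max_sub_sub_right]
      · rw [maxRhs_of_lt h, maxRhs_of_lt (by rwa [← h1, ← h2]), max_eq_left h.le, h3]
    · rw [image_eq_zero_of_notMem_tsupport fun h => hx (hφK h), mul_zero, mul_zero]
  rw [subsolution_iff_of_tsupport_subset hKm hrΩ hχ1' b hw
    (integrableOn_maxRhs hum hvm hfK hgK) hcw hφK hH]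
  refine max_subsolution_of_compactly_supported_drift hn hs0 hs1 hB hBc hum' hvm' hFm hGm hu' hv'
    (hF.congr hFF) (hG.congr hGG) φ.contDiff φ.hasCompactSupport hφ0 hr ?_ ?_
  · intro ψ hψ hψc hψ0 hψK
    let Ψ : 𝓓(Ω, ℝ) := ⟨ψ, hψ, hψc, hψK.trans hrΩ⟩
    have hHψ : ∀ᵐ x, K.indicator (fun x => f x - c x * u x) x * Ψ x = F x * Ψ x := by
      filter_upwards [hFF] with x hx
      rw [hx]
    exact (subsolution_iff_of_tsupport_subset (ψ := Ψ) hKm hrΩ hχ1' b huu' hfK hcu hψK hHψ).1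
      (hsubu Ψ hψ0)
  · intro ψ hψ hψc hψ0 hψK
    let Ψ : 𝓓(Ω, ℝ) := ⟨ψ, hψ, hψc, hψK.trans hrΩ⟩
    have hHψ : ∀ᵐ x, K.indicator (fun x => g x - c x * v x) x * Ψ x = G x * Ψ x := by
      filter_upwards [hGG] with x hx
      rw [hx]
    exact (subsolution_iff_of_tsupport_subset (ψ := Ψ) hKm hrΩ hχ1' b hvv' hgK hcv hψK hHψ).1
      (hsubv Ψ hψ0)

end FracMax

end

theorem theorem1p7 (n : ℕ) (hn : 1 ≤ n) (s : ℝ) (hs0 : 0 < s) (hs1 : s < 1)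
    (Ω : Opens (FracMax.Rn n)) (hΩ : IsConnected (Ω : Set (FracMax.Rn n)))
    (b : FracMax.Rn n → FracMax.Rn n) (hb : FracMax.BoundedC1On b Ω)
    (c : FracMax.Rn n → ℝ) (hc : MemLp c ∞ (volume.restrict (Ω : Set (FracMax.Rn n))))
    (u v f g : FracMax.Rn n → ℝ)
    (hu : FracMax.MemL (2 * s) u) (hv : FracMax.MemL (2 * s) v)
    (hf : LocallyIntegrableOn f (Ω : Set (FracMax.Rn n)) volume)
    (hg : LocallyIntegrableOn g (Ω : Set (FracMax.Rn n)) volume)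
    (hsubu : FracMax.IsSubsolution Ω s b c u f)
    (hsubv : FracMax.IsSubsolution Ω s b c v g) :
    FracMax.MemL (2 * s) (fun x => max (u x) (v x)) ∧
    LocallyIntegrableOn (FracMax.maxRhs u v f g) (Ω : Set (FracMax.Rn n)) volume ∧
    FracMax.IsSubsolution Ω s b c (fun x => max (u x) (v x)) (FracMax.maxRhs u v f g) := by
  have hum := hu.aestronglyMeasurable hs0
  have hvm := hv.aestronglyMeasurable hs0
  exact ⟨FracMax.memL_iff.2 (FracMax.integrable_max_mul_wt (FracMax.memL_iff.1 hu)
    (FracMax.memL_iff.1 hv)), FracMax.locallyIntegrableOn_maxRhs hum hvm hf hg,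
    FracMax.isSubsolution_max hn hs0 hs1 hb.1 hc hu hv hf hg hsubu hsubv⟩
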